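/- All local rings are commutative and Noetherian, and $\lambda$ denotes length. Let $R$ be a Gorenstein local ring and let $I\subseteq R$ be an ideal such that $R/I$ has finite length. For an ideal $L$ of a Gorenstein local ring $A$ with $A/L$ of finite length, let $\omega_{A/L}=\operatorname{Ext}^{h}_A(A/L,A)$, $h=\operatorname{height}L$, be the canonical module of $A/L$; let $(L/L^2)\otimes_{A/L}\omega_{A/L}$ be the twisted conormal module; and consider the inequality $$(\ast)\qquad \lambda_A\big((L/L^2)\otimes_{A/L}\omega_{A/L}\big)\ \ge\ (\dim A)\cdot\lambda_A(A/L).$$ We say that the pair $(R,I)$ deforms to a pair $(Q,J)$, where $Q$ is a local ring and $J\subseteq Q$ an ideal, if there are a sequence $\underline x$ in $Q$ that is regular on $Q$ and on $Q/J$, and a surjective ring homomorphism $\pi\colon Q\to R$ with kernel $(\underline x)$ and $\pi(J)=I$ (so that $Q/(\underline x)\cong R$ and $Q/(J+(\underline x))\cong R/I$). We say that $R$ deforms to $Q$ if $(R,0)$ deforms to $(Q,0)$; in that case $Q$ is again Gorenstein. The pair $(R,I)$ is smoothable if it deforms to some $(Q,J)$ such that for every associated prime $\mathfrak q$ of $Q/J$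 the ideal $J_{\mathfrak q}\subset Q_{\mathfrak q}$ is generated by a regular sequence. Proper ideals $I_1,I_2$ of $R$ are linked if there is a regular sequence $\underline x$ in $I_1\cap I_2$ with $I_2=((\underline x):_R I_1)$ and $I_1=((\underline x):_R I_2)$; the ideal $I$ is licci if there is a finite chain of ideals $I=I_0,I_1,\dots,I_n$ ($n\ge 0$), consecutive ones being linked, such that $I_n$ is generated by a regular sequence. Then $(\ast)$ holds for $(A,L)=(R,I)$ whenever one of the following conditions holds: 1. $R$ deforms to a local ring $Q$, with quotient map $\pi\colon Q\to R$, and $(\ast)$ holds for $(A,L)=(Q,\pi^{-1}(I))$; 2. $(R,I)$ is smoothable; 3. $I$ is licci. -/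

import Mathlib

universe u v

open CategoryTheory RingTheory.Sequence

/-- A Gorenstein local ring: a Noetherian local ring of finite injective dimension over itself. -/
class IsGorensteinLocalRing (R : Type u) [CommRing R] : Prop
    extends IsLocalRing R, IsNoetherianRing R where
  exists_hasInjectiveDimensionLE :
    ∃ n : ℕ, HasInjectiveDimensionLE (ModuleCat.of R R) n

/-- The module `Ext^d_R(R/I, R)` with `d = height I`. It is the canonical module `ω_{R/I}` of `R/I`
when `R` is a Gorenstein local ring and `R/I` is Cohen-Macaulay (in particular, when `R/I` has
finite length). -/
def QuotCanonicalModule {R : Type u} [CommRing R] (I : Ideal R) : Type u :=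
  Abelian.Ext (ModuleCat.of R (R ⧸ I)) (ModuleCat.of R R) I.height.toNat

namespace QuotCanonicalModule

variable {R : Type u} [CommRing R] (I : Ideal R)

noncomputable instance : AddCommGroup (QuotCanonicalModule I) :=
  inferInstanceAs (AddCommGroup
    (Abelian.Ext (ModuleCat.of R (R ⧸ I)) (ModuleCat.of R R) I.height.toNat))

noncomputable instance : Module R (QuotCanonicalModule I) :=
  inferInstanceAs (Module R
    (Abelian.Ext (ModuleCat.of R (R ⧸ I)) (ModuleCat.of R R) I.height.toNat))

theorem isTorsionBySet : Module.IsTorsionBySet R (QuotCanonicalModule I) I := by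
  intro x r
  have h : (r : R) • 𝟙 (ModuleCat.of R (R ⧸ I)) = 0 := by
    refine ModuleCat.hom_ext (LinearMap.ext fun z => ?_)
    obtain ⟨y, rfl⟩ := Ideal.Quotient.mk_surjective z
    change Ideal.Quotient.mk I ((r : R) * y) = 0
    exact Ideal.Quotient.eq_zero_iff_mem.mpr (I.mul_mem_right _ r.2)
  let x' : Abelian.Ext (ModuleCat.of R (R ⧸ I)) (ModuleCat.of R R) I.height.toNat := x
  change (r : R) • x' = 0
  rw [← Abelian.Ext.mk₀_id_comp x', ← Abelian.Ext.smul_comp, ← Abelian.Ext.mk₀_smul, h]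
  simp

noncomputable instance : Module (R ⧸ I) (QuotCanonicalModule I) :=
  (isTorsionBySet I).module

instance : IsScalarTower R (R ⧸ I) (QuotCanonicalModule I) :=
  (isTorsionBySet I).isScalarTower

end QuotCanonicalModule

/-- The twisted conormal module `(I/I²) ⊗_{R/I} ω_{R/I}`. -/
abbrev TwistedConormal {R : Type u} [CommRing R] (I : Ideal R) : Type u :=
  TensorProduct (R ⧸ I) I.Cotangent (QuotCanonicalModule I)

/-- The inequality `λ_R((I/I²) ⊗ ω_{R/I}) ≥ (dim R) · λ_R(R/I)`. -/
def ConormalInequality {R : Type u} [CommRing R] (I : Ideal R) : Prop :=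
  ringKrullDim R * (Module.length R (R ⧸ I) : WithBot ℕ∞) ≤
    (Module.length R (TwistedConormal I) : WithBot ℕ∞)

/-- The pair `(R, I)` deforms to the pair `(Q, J)`, with quotient map `π : Q ↠ R`: the kernel of the
surjection `π` is generated by a sequence that is regular on `Q` and on `Q/J`, and `I` is the image
of `J`. Thus `Q/(x) ≅ R` and, compatibly, `Q/(J + (x)) ≅ R/I`. -/
def DeformsAlong {R : Type u} {Q : Type v} [CommRing R] [CommRing Q] (π : Q →+* R)
    (I : Ideal R) (J : Ideal Q) : Prop :=
  Function.Surjective π ∧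
    ∃ xs : List Q, IsRegular Q xs ∧ IsRegular (Q ⧸ J) xs ∧
      RingHom.ker π = Ideal.ofList xs ∧ J.map π = I

/-- A complete intersection ideal: one that can be generated by a regular sequence. -/
def IsCompleteIntersectionIdeal {R : Type u} [CommRing R] (I : Ideal R) : Prop :=
  ∃ xs : List R, IsRegular R xs ∧ I = Ideal.ofList xs

/-- For each associated prime `q` of `Q/J`, the ideal `J_q` is generated by a regular sequence. -/
def IsGenericallyCompleteIntersection {Q : Type u} [CommRing Q] (J : Ideal Q) : Prop :=
  ∀ (q : Ideal Q) [q.IsPrime], q ∈ associatedPrimes Q (Q ⧸ J) →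
    IsCompleteIntersectionIdeal (J.map (algebraMap Q (Localization.AtPrime q)))

/-- `(R, I)` deforms to some `(Q, J)` with `Q` a Noetherian local ring and `J` generically a
complete intersection. -/
def IsSmoothable {R : Type u} [CommRing R] (I : Ideal R) : Prop :=
  ∃ (Q : Type v) (_ : CommRing Q) (_ : IsLocalRing Q) (_ : IsNoetherianRing Q)
    (π : Q →+* R) (J : Ideal Q), DeformsAlong π I J ∧ IsGenericallyCompleteIntersection J

/-- Proper ideals `I`, `J` are linked if, for some regular sequence `xs` contained in `I ∩ J`,
`J = ((xs) : I)` and `I = ((xs) : J)`. -/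
def IsLinked {R : Type u} [CommRing R] (I J : Ideal R) : Prop :=
  I ≠ ⊤ ∧ J ≠ ⊤ ∧ ∃ xs : List R, IsRegular R xs ∧ Ideal.ofList xs ≤ I ⊓ J ∧
    J = (Ideal.ofList xs).colon (I : Set R) ∧ I = (Ideal.ofList xs).colon (J : Set R)

/-- `I` is licci: a finite chain of links joins it to a complete intersection ideal. -/
def IsLicci {R : Type u} [CommRing R] (I : Ideal R) : Prop :=
  ∃ J : Ideal R, Relation.ReflTransGen IsLinked I J ∧ IsCompleteIntersectionIdeal J

-- Write d = dim R and choose a regular sequence of length d inside I, generating F. Since R is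
-- Gorenstein, R/F has simple socle, so Hom(-, R/F) is a length-preserving, reflexive duality on
-- finite modules killed by F. Also ω = Ext^d(R/I, R) ≅ Hom(R/I, R/F), and by adjunction (I/I²) ⊗ ω
-- is dual to Hom(I/I², R/I) = Hom(I, R/I). Thus (∗) says d·λ(R/I) ≤ λ(Hom_R(I, R/I))
-- (`length_twistedConormal`, `conormalInequality_iff`): a lower bound for the space of first-order
-- deformations of I. The facts on Gorenstein rings are derived from finite injective dimension in
-- `IsGorensteinLocalRing.exists_isRegular_subsingleton_ext` and
-- `IsGorensteinLocalRing.hasCyclicSocle`. The unit ideal is treated apart.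
--
-- Deformation of the ring: let Q → R have kernel (x) and J = π⁻¹(I). Restricting maps J → Q/J to
-- (x) loses at most |x|·λ(R/I), and the maps vanishing on (x) come from Hom_R(I, R/I)
-- (`length_hom_comap_le`). As dim Q = dim R + |x|, the inequality descends.
--
-- Linkage: for I and J linked by F, a flag pair (α, β) in Hom(F, R/F) × Hom(I, R/I) determines β'
-- in Hom(J, R/J) by the Leibniz rule α(xy) = β(x)y + xβ'(y). Comparing lengths of flag pairs for I
-- and J shows that λ(Hom(I, R/I)) − d·λ(R/I) does not change along a link
-- (`length_hom_add_le_of_link`, in either direction). For a complete intersection it is 0.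
--
-- Smoothability: put S = Q/J and let x be the regular sequence with R = Q/(x), of length n. A
-- regular sequence of length d in J and the generic complete intersection property give a map h : J
-- → S^d whose cokernel is killed by an S-regular element s
-- (`IsGenericallyCompleteIntersection.exists_linearMap`). Apply Hom(-, X_k) for X_k = S/(x₁^k, ...,
-- x_n^k). Filtering X_k by copies of R/I gives λ(X_k) = k^n·λ(R/I) and λ(Hom(J, X_k)) ≤
-- k^n·λ(Hom_R(I, R/I)), while the error caused by s is d·λ(X_k/sX_k) = O(k^(n-1)), because dim S/sS
-- < n. Dividing by k^n for large k gives the inequality (`mul_le_of_forall_pow_mul_le`).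

universe w

/-! ### Ext and regular sequences; pieces of the long exact sequence. -/

section ExtFacts

variable {R : Type u} [CommRing R]

open Abelian

theorem smul_ext_eq_zero_of_mem_annihilator {M N : ModuleCat.{u} R} {r : R}
    (hr : r ∈ Module.annihilator R M) {i : ℕ} (x : Ext M N i) : r • x = 0 := by
  have h : r • 𝟙 M = 0 := by
    refine ModuleCat.hom_ext (LinearMap.ext fun z => ?_)
    exact Module.mem_annihilator.mp hr z
  rw [← Ext.mk₀_id_comp x, ← Ext.smul_comp, ← Ext.mk₀_smul, h]
  simp

theorem support_subset_zeroLocus_ofList {M : Type u} [AddCommGroup M] [Module R M]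
    [Module.Finite R M] {I : Ideal R} (hM : I ≤ Module.annihilator R M) :
    Module.support R M ⊆ PrimeSpectrum.zeroLocus I := by
  rw [Module.support_eq_zeroLocus]
  exact PrimeSpectrum.zeroLocus_anti_mono hM

/-- Rees's dimension shift. For 0 → N → N → N/yN → 0 the connecting map into the top Ext is
injective because Ext of M into N vanishes below the length of the sequence, and surjective because
y kills M and hence Ext. -/
theorem exists_ext_length_equiv_linearMap [IsNoetherianRing R] (M : ModuleCat.{u} R)
    [Module.Finite R M] (ys : List R) (N : ModuleCat.{u} R) [Module.Finite R N]
    (reg : IsRegular N ys) (hM : Ideal.ofList ys ≤ Module.annihilator R M) :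
    Nonempty (Ext M N ys.length ≃ₗ[R]
      (M →ₗ[R] (N ⧸ (Ideal.ofList ys • ⊤ : Submodule R N)))) := by
  induction ys generalizing N with
  | nil =>
    refine ⟨(Ext.linearEquiv₀ (R := R)).trans (ModuleCat.homLinearEquiv.trans
      (LinearEquiv.congrRight (Submodule.quotEquivOfEqBot _ ?_).symm))⟩
    simp
  | cons y ys ih =>
    have hsub : Subsingleton (Ext M N ys.length) :=
      ModuleCat.subsingleton_ext_of_exists_isRegular (Ideal.ofList (y :: ys)) M
        (support_subset_zeroLocus_ofList hM) N (lt_top_iff_ne_top.mpr reg.2.symm) (y :: ys)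
        (fun r hr => Ideal.subset_span hr) reg _ (by simp)
    have hy : y ∈ Module.annihilator R M := hM (Ideal.subset_span (by simp))
    have reg' := (isRegular_cons_iff N y ys).mp reg
    have hS := reg'.1.smulShortComplex_shortExact (M := N)
    obtain ⟨e⟩ := ih (ModuleCat.of R (QuotSMulTop y N)) reg'.2
      (le_trans (by rw [Ideal.ofList_cons]; exact le_sup_right) hM)
    let δ : Ext M (ModuleCat.of R (QuotSMulTop y N)) ys.length →ₗ[R]
        Ext M N (ys.length + 1) := hS.extClass.postcompOfLinear R M rfl
    have hδ : Function.Bijective δ := by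
      constructor
      · rw [injective_iff_map_eq_zero]
        intro x hx
        obtain ⟨x₂, hx₂⟩ := Ext.covariant_sequence_exact₃ M hS x rfl hx
        have h0 : x₂ = 0 := hsub.elim _ _
        rw [← hx₂, h0, Ext.zero_comp]
        rfl
      · intro x
        refine Ext.covariant_sequence_exact₁ M hS x ?_ rfl
        have := smul_ext_eq_zero_of_mem_annihilator hy x
        rwa [Ext.smul_eq_comp_mk₀] at this
    exact ⟨(LinearEquiv.ofBijective δ hδ).symm.trans (e.trans (LinearEquiv.congrRight
      (Submodule.quotOfListConsSMulTopEquivQuotSMulTopInner N y ys).symm))⟩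

theorem exists_ext_length_equiv_linearMap_quotient [IsNoetherianRing R] (M : Type u)
    [AddCommGroup M] [Module R M] [Module.Finite R M] (ys : List R) (reg : IsRegular R ys)
    (hM : Ideal.ofList ys ≤ Module.annihilator R M) :
    Nonempty (Ext (ModuleCat.of R M) (ModuleCat.of R R) ys.length ≃ₗ[R]
      (M →ₗ[R] (R ⧸ Ideal.ofList ys))) := by
  obtain ⟨e⟩ := exists_ext_length_equiv_linearMap (ModuleCat.of R M) ys (ModuleCat.of R R) reg hM
  refine ⟨e.trans (LinearEquiv.congrRight (Submodule.quotEquivOfEq _ _ ?_))⟩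
  exact (Ideal.ofList ys).mul_top

theorem shortExact_of_exact {M₁ M₂ M₃ : Type u} [AddCommGroup M₁] [AddCommGroup M₂]
    [AddCommGroup M₃] [Module R M₁] [Module R M₂] [Module R M₃] {f : M₁ →ₗ[R] M₂}
    {g : M₂ →ₗ[R] M₃} (hf : Function.Injective f) (hfg : Function.Exact f g)
    (hg : Function.Surjective g) :
    (ModuleCat.shortComplexOfCompEqZero f g hfg.linearMap_comp_eq_zero).ShortExact :=
  ModuleCat.shortComplex_shortExact _ hfg hf hg

section
variable {M₁ M₂ M₃ : Type u} [AddCommGroup M₁] [AddCommGroup M₂]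
    [AddCommGroup M₃] [Module R M₁] [Module R M₂] [Module R M₃] {f : M₁ →ₗ[R] M₂}
    {g : M₂ →ₗ[R] M₃} (hf : Function.Injective f) (hfg : Function.Exact f g)
    (hg : Function.Surjective g) (N : ModuleCat.{u} R)

include hf hfg hg

theorem subsingleton_ext_middle (i : ℕ)
    (h₁ : Subsingleton (Ext (ModuleCat.of R M₁) N i))
    (h₃ : Subsingleton (Ext (ModuleCat.of R M₃) N i)) :
    Subsingleton (Ext (ModuleCat.of R M₂) N i) := by
  refine subsingleton_of_forall_eq 0 fun x => ?_
  obtain ⟨z, hz⟩ := Ext.contravariant_sequence_exact₂ (shortExact_of_exact hf hfg hg) N x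
    (h₁.elim _ _)
  rw [← hz, h₃.elim z 0, Ext.comp_zero]

theorem ext_precomp_surjective (i : ℕ)
    (h₃ : Subsingleton (Ext (ModuleCat.of R M₃) N (i + 1))) :
    Function.Surjective ((Ext.mk₀ (ModuleCat.ofHom f)).precompOfLinear R N (zero_add i)) := by
  intro x
  exact Ext.contravariant_sequence_exact₁ (shortExact_of_exact hf hfg hg) N x
    (add_comm 1 i) (h₃.elim _ _)

theorem subsingleton_ext_left (i : ℕ)
    (h₂ : Subsingleton (Ext (ModuleCat.of R M₂) N i))
    (h₃ : Subsingleton (Ext (ModuleCat.of R M₃) N (i + 1))) :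
    Subsingleton (Ext (ModuleCat.of R M₁) N i) :=
  (ext_precomp_surjective hf hfg hg N i h₃).subsingleton

/-- Quantifying over j with j + 1 = i makes the hypothesis empty in degree 0, where injectivity is
just that g is an epimorphism. -/
theorem ext_precomp_injective (i : ℕ)
    (h₁ : ∀ j, j + 1 = i → Subsingleton (Ext (ModuleCat.of R M₁) N j)) :
    Function.Injective ((Ext.mk₀ (ModuleCat.ofHom g)).precompOfLinear R N (zero_add i)) := by
  cases i with
  | zero =>
    have : Epi (ModuleCat.ofHom g) := (ModuleCat.epi_iff_surjective _).mpr hg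
    exact Ext.precomp_mk₀_injective_of_epi N (ModuleCat.ofHom g)
  | succ i =>
    rw [injective_iff_map_eq_zero]
    intro x hx
    obtain ⟨z, hz⟩ := Ext.contravariant_sequence_exact₃ (shortExact_of_exact hf hfg hg) N x hx
      (add_comm 1 i)
    rw [← hz, (h₁ i rfl).elim z 0, Ext.comp_zero]

theorem length_ext_eq_add (i : ℕ)
    (h₁ : ∀ j, j + 1 = i → Subsingleton (Ext (ModuleCat.of R M₁) N j))
    (h₃ : Subsingleton (Ext (ModuleCat.of R M₃) N (i + 1))) :
    Module.length R (Ext (ModuleCat.of R M₂) N i) =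
      Module.length R (Ext (ModuleCat.of R M₃) N i) +
        Module.length R (Ext (ModuleCat.of R M₁) N i) := by
  refine Module.length_eq_add_of_exact
    ((Ext.mk₀ (ModuleCat.ofHom g)).precompOfLinear R N (zero_add i))
    ((Ext.mk₀ (ModuleCat.ofHom f)).precompOfLinear R N (zero_add i))
    (ext_precomp_injective hf hfg hg N i h₁) (ext_precomp_surjective hf hfg hg N i h₃) ?_
  have := Ext.contravariant_sequence_exact₂' (shortExact_of_exact hf hfg hg) N i
  rw [ShortComplex.ab_exact_iff_function_exact] at this
  exact this

end

theorem subsingleton_ext_congr {M M' : Type u} [AddCommGroup M] [Module R M] [AddCommGroup M']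
    [Module R M'] (e : M ≃ₗ[R] M') (N : ModuleCat.{u} R) (i : ℕ)
    (h : Subsingleton (Ext (ModuleCat.of R M') N i)) :
    Subsingleton (Ext (ModuleCat.of R M) N i) := by
  refine subsingleton_of_forall_eq 0 fun x => ?_
  have h1 : x = (Ext.mk₀ (ModuleCat.ofHom e.toLinearMap)).comp
      ((Ext.mk₀ (ModuleCat.ofHom e.symm.toLinearMap)).comp x (zero_add i)) (zero_add i) := by
    rw [Ext.mk₀_comp_mk₀_assoc, ← ModuleCat.ofHom_comp]
    simp
  rw [h1, h.elim ((Ext.mk₀ (ModuleCat.ofHom e.symm.toLinearMap)).comp x (zero_add i)) 0,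
    Ext.comp_zero]

end ExtFacts

section

variable {R : Type u} [CommRing R]

/-- Linear maps out of a cyclic module `R ⧸ 𝔞` into a module killed by `𝔞`. -/
def linearMapQuotientEquiv (𝔞 : Ideal R) (N : Type v) [AddCommGroup N] [Module R N]
    (h : ∀ a ∈ 𝔞, ∀ n : N, a • n = 0) : ((R ⧸ 𝔞) →ₗ[R] N) ≃ₗ[R] N where
  toFun f := f (Ideal.Quotient.mk 𝔞 1)
  map_add' _ _ := rfl
  map_smul' _ _ := rfl
  invFun n := 𝔞.liftQ (LinearMap.toSpanSingleton R N n) fun r hr => h r hr n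
  left_inv f := by
    refine Submodule.linearMap_qext _ (LinearMap.ext_ring ?_)
    change (1 : R) • f (Ideal.Quotient.mk 𝔞 1) = _
    rw [one_smul]
    rfl
  right_inv n := one_smul R n

end

/-! ### Consequences of finite injective dimension. -/

section Gorenstein

open Abelian IsLocalRing

variable {R : Type u} [CommRing R] [IsLocalRing R] [IsNoetherianRing R]

/-- An element a of the maximal ideal outside p is injective on R/p. Since the next Ext of the
cokernel vanishes, multiplication by a is surjective on the finite module Ext^i(R/p, N), and
Nakayama applies. -/
theorem subsingleton_ext_quotient_prime (N : ModuleCat.{u} R) [Module.Finite R N] (i : ℕ)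
    (hi : ∀ (M : Type u) [AddCommGroup M] [Module R M] [Module.Finite R M],
      Subsingleton (Ext (ModuleCat.of R M) N (i + 1)))
    (p : Ideal R) [p.IsPrime] (hp : p ≠ maximalIdeal R) :
    Subsingleton (Ext (ModuleCat.of R (R ⧸ p)) N i) := by
  obtain ⟨a, ham, hap⟩ : ∃ a ∈ maximalIdeal R, a ∉ p := by
    by_contra! h
    exact hp (le_antisymm (le_maximalIdeal Ideal.IsPrime.ne_top') h)
  let f : (R ⧸ p) →ₗ[R] (R ⧸ p) := LinearMap.lsmul R (R ⧸ p) a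
  have hf : Function.Injective f := by
    rw [injective_iff_map_eq_zero]
    intro x hx
    obtain ⟨x, rfl⟩ := Ideal.Quotient.mk_surjective x
    have hx' : Ideal.Quotient.mk p (a * x) = 0 := hx
    rw [Ideal.Quotient.eq_zero_iff_mem] at hx' ⊢
    exact (Ideal.IsPrime.mem_or_mem ‹_› hx').resolve_left hap
  have hsurj := ext_precomp_surjective hf (LinearMap.exact_map_mkQ_range f)
    (Submodule.mkQ_surjective _) N i (hi _)
  have hbot : (⊤ : Submodule R (Ext (ModuleCat.of R (R ⧸ p)) N i)) = ⊥ := by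
    refine Submodule.eq_bot_of_le_smul_of_le_jacobson_bot (Ideal.span {a}) ⊤
      (Module.finite_def.mp (ModuleCat.finite_ext R _ _ i)) ?_ ?_
    · intro x _
      obtain ⟨y, rfl⟩ := hsurj x
      have : ((Ext.mk₀ (ModuleCat.ofHom f)).precompOfLinear R N (zero_add i)) y = a • y := by
        have hfa : ModuleCat.ofHom f = a • 𝟙 (ModuleCat.of R (R ⧸ p)) := rfl
        change (Ext.mk₀ (ModuleCat.ofHom f)).comp y (zero_add i) = a • y
        rw [hfa, Ext.mk₀_smul, Ext.smul_comp, Ext.mk₀_id_comp]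
      rw [this]
      exact Submodule.smul_mem_smul (Ideal.mem_span_singleton_self a) trivial
    · rw [Ideal.span_singleton_le_iff_mem]
      exact maximalIdeal_le_jacobson _ ham
  exact (Submodule.subsingleton_iff R).mp (subsingleton_of_bot_eq_top hbot.symm)

omit [IsLocalRing R] [IsNoetherianRing R] in
theorem subsingleton_ext_of_subsingleton (M : Type u) [AddCommGroup M] [Module R M]
    [Subsingleton M] (N : ModuleCat.{u} R) (i : ℕ) :
    Subsingleton (Ext (ModuleCat.of R M) N i) := by
  refine subsingleton_of_forall_eq 0 fun x => ?_
  have : 𝟙 (ModuleCat.of R M) = 0 :=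
    ModuleCat.hom_ext (LinearMap.ext fun z => Subsingleton.elim (α := M) _ _)
  rw [← Ext.mk₀_id_comp x, this]
  simp

/-- A prime filtration reduces to M = R/p, and non-maximal p are covered by the preceding Nakayama
argument; only the residue field has to be tested. -/
theorem subsingleton_ext_of_subsingleton_ext_residue (N : ModuleCat.{u} R) [Module.Finite R N]
    (i : ℕ) (hi : ∀ (M : Type u) [AddCommGroup M] [Module R M] [Module.Finite R M],
      Subsingleton (Ext (ModuleCat.of R M) N (i + 1)))
    (hk : Subsingleton (Ext (ModuleCat.of R (R ⧸ maximalIdeal R)) N i))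
    (M : Type u) [AddCommGroup M] [Module R M] [Module.Finite R M] :
    Subsingleton (Ext (ModuleCat.of R M) N i) := by
  refine IsNoetherianRing.induction_on_isQuotientEquivQuotientPrime R ‹_›
    (motive := fun M _ _ _ => Subsingleton (Ext (ModuleCat.of R M) N i)) ?_ ?_ ?_
  · intro M _ _ _ _
    exact subsingleton_ext_of_subsingleton M N i
  · intro M _ _ _ p e
    refine subsingleton_ext_congr e N i ?_
    by_cases hp : p.asIdeal = maximalIdeal R
    · rw [hp]; exact hk
    · exact subsingleton_ext_quotient_prime N i hi p.asIdeal hp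
  · intro M₁ _ _ _ M₂ _ _ _ M₃ _ _ _ f g hf hg hfg h₁ h₃
    exact subsingleton_ext_middle hf hfg hg N i h₁ h₃

omit [IsNoetherianRing R] in
theorem mem_maximalIdeal_of_isRegular {ys : List R} (reg : IsRegular R ys) :
    Ideal.ofList ys ≤ maximalIdeal R := by
  refine le_maximalIdeal fun h => reg.2 ?_
  rw [h]
  exact (Ideal.mul_top _).symm

omit [IsLocalRing R] [IsNoetherianRing R] in
theorem ofList_smul_top_lt {I : Ideal R} (hI : I ≠ ⊤) : I • (⊤ : Submodule R R) < ⊤ := by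
  rw [lt_top_iff_ne_top]
  intro h
  apply hI
  rwa [smul_eq_mul, Ideal.mul_top] at h

theorem length_le_ringKrullDim_of_isRegular {ys : List R} (reg : IsRegular R ys) :
    (ys.length : WithBot ℕ∞) ≤ ringKrullDim R := by
  have h := ringKrullDim_add_length_eq_ringKrullDim_of_isRegular ys reg
  have : Nontrivial (R ⧸ Ideal.ofList ys) := Ideal.Quotient.nontrivial_iff.mpr
    (ne_top_of_le_ne_top (maximalIdeal.isMaximal R).ne_top (mem_maximalIdeal_of_isRegular reg))
  rw [← h]
  exact le_add_of_nonneg_left ringKrullDim_nonneg_of_nontrivial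

variable (R) in
theorem exists_ringKrullDim_eq_natCast : ∃ d : ℕ, ringKrullDim R = d := by
  have h1 : ringKrullDim R ≠ ⊤ := ringKrullDim_ne_top
  have h2 : ringKrullDim R ≠ ⊥ := ringKrullDim_ne_bot
  obtain ⟨e, he⟩ := WithBot.ne_bot_iff_exists.mp h2
  rw [← he] at h1 ⊢
  obtain ⟨n, hn⟩ := ENat.ne_top_iff_exists.mp (show e ≠ ⊤ by rintro rfl; exact h1 rfl)
  exact ⟨n, by rw [← hn]; rfl⟩

-- Take a regular sequence of maximal length; the dimension bounds it. If the socle of the quotient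
-- were zero, one more Ext of the residue field would vanish, giving a longer regular sequence.
variable (R) in
theorem exists_isRegular_nontrivial_linearMap_residue :
    ∃ ys : List R, IsRegular R ys ∧
      Nontrivial ((R ⧸ maximalIdeal R) →ₗ[R] (R ⧸ Ideal.ofList ys)) := by
  classical
  obtain ⟨d, hd⟩ := exists_ringKrullDim_eq_natCast R
  let P : ℕ → Prop := fun n => ∃ ys : List R, ys.length = n ∧ IsRegular R ys
  have hP0 : P 0 := ⟨[], rfl, IsRegular.nil R R⟩
  have hbound : ∀ n, P n → n ≤ d := by
    rintro n ⟨ys, rfl, reg⟩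
    have := length_le_ringKrullDim_of_isRegular reg
    rw [hd] at this
    exact_mod_cast this
  have hspec : P (Nat.findGreatest P d) := Nat.findGreatest_spec (Nat.zero_le d) hP0
  obtain ⟨ys, hlen, reg⟩ := hspec
  refine ⟨ys, reg, ?_⟩
  by_contra hnt
  rw [not_nontrivial_iff_subsingleton] at hnt
  have hmem : ∀ r ∈ ys, r ∈ maximalIdeal R := fun r hr =>
    mem_maximalIdeal_of_isRegular reg (Ideal.subset_span hr)
  have hlt := ofList_smul_top_lt (maximalIdeal.isMaximal R).ne_top
  have hsupp : Module.support R (R ⧸ maximalIdeal R) =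
      PrimeSpectrum.zeroLocus (maximalIdeal R) := by
    rw [Module.support_eq_zeroLocus, Ideal.annihilator_quotient]
  obtain ⟨e⟩ := exists_ext_length_equiv_linearMap_quotient (R ⧸ maximalIdeal R) ys reg
    (by rw [Ideal.annihilator_quotient]; exact mem_maximalIdeal_of_isRegular reg)
  have hext : ∀ i < ys.length + 1, Subsingleton
      (Ext (ModuleCat.of R (R ⧸ maximalIdeal R)) (ModuleCat.of R R) i) := by
    intro i hi
    rcases Nat.lt_succ_iff_lt_or_eq.mp hi with hi | rfl
    · exact ModuleCat.subsingleton_ext_of_exists_isRegular (maximalIdeal R)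
        (ModuleCat.of R (R ⧸ maximalIdeal R)) hsupp.subset (ModuleCat.of R R) hlt ys hmem reg i hi
    · exact e.toEquiv.subsingleton
  obtain ⟨zs, hzs, -, regz⟩ := ModuleCat.exists_isRegular_of_exists_subsingleton_ext
    (maximalIdeal R) (ys.length + 1) (ModuleCat.of R R) hlt
    (ModuleCat.of R (R ⧸ maximalIdeal R)) hsupp hext
  have hPz : P (ys.length + 1) := ⟨zs, hzs, regz⟩
  have := Nat.le_findGreatest (hbound _ hPz) hPz
  omega

theorem subsingleton_ext_quotient_ofList {ys : List R} (reg : IsRegular R ys)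
    (N : ModuleCat.{u} R) {i : ℕ} (hi : ys.length < i) :
    Subsingleton (Ext (ModuleCat.of R (R ⧸ Ideal.ofList ys)) N i) := by
  have h := ModuleCat.projectiveDimension_quotient_eq_length.{u} ys reg
  have h' : HasProjectiveDimensionLE
      (ModuleCat.of R (Shrink.{u} (R ⧸ Ideal.ofList ys))) ys.length := by
    rw [← projectiveDimension_le_iff, h]
  have := HasProjectiveDimensionLT.subsingleton
    (ModuleCat.of R (Shrink.{u} (R ⧸ Ideal.ofList ys))) (ys.length + 1) i hi N
  exact subsingleton_ext_congr (Shrink.linearEquiv R (R ⧸ Ideal.ofList ys)).symm N i this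

/-- The residue field embeds in R/(ys), which has projective dimension |ys|. Once Ext^(i+1) vanishes
on all finite modules, Ext^i of R/(ys) surjects onto Ext^i of the residue field, so this is zero for
i > |ys|. -/
theorem subsingleton_ext_self_of_length_lt {n : ℕ}
    (hn : HasInjectiveDimensionLE (ModuleCat.of R R) n) {ys : List R} (reg : IsRegular R ys)
    (hk : Nontrivial ((R ⧸ maximalIdeal R) →ₗ[R] (R ⧸ Ideal.ofList ys))) {i : ℕ}
    (hi : ys.length < i) (M : Type u) [AddCommGroup M] [Module R M] [Module.Finite R M] :
    Subsingleton (Ext (ModuleCat.of R M) (ModuleCat.of R R) i) := by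
  by_cases hin : n + 1 ≤ i
  · exact HasInjectiveDimensionLT.subsingleton (ModuleCat.of R R) (n + 1) i hin _
  -- Descending induction on i, starting above the injective dimension.
  obtain ⟨j, hj⟩ : ∃ j, n + 1 = i + j := ⟨n + 1 - i, by omega⟩
  induction j generalizing i M with
  | zero => omega
  | succ j ih =>
    have hnext : ∀ (M : Type u) [AddCommGroup M] [Module R M] [Module.Finite R M],
        Subsingleton (Ext (ModuleCat.of R M) (ModuleCat.of R R) (i + 1)) := by
      intro M _ _ _
      by_cases h : n + 1 ≤ i + 1
      · exact HasInjectiveDimensionLT.subsingleton (ModuleCat.of R R) (n + 1) (i + 1) h _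
      · exact ih (by omega) M h (by omega)
    refine subsingleton_ext_of_subsingleton_ext_residue _ i hnext ?_ M
    obtain ⟨f, hf⟩ := exists_ne (0 : (R ⧸ maximalIdeal R) →ₗ[R] (R ⧸ Ideal.ofList ys))
    have : IsSimpleModule R (R ⧸ maximalIdeal R) :=
      isSimpleModule_iff_quot_maximal.mpr ⟨_, maximalIdeal.isMaximal R, ⟨LinearEquiv.refl _ _⟩⟩
    have hinj : Function.Injective f := LinearMap.injective_of_ne_zero hf
    exact subsingleton_ext_left hinj (LinearMap.exact_map_mkQ_range f) (Submodule.mkQ_surjective _)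
      _ i (subsingleton_ext_quotient_ofList reg _ hi) (hnext _)

omit [IsLocalRing R] in
theorem isFiniteLength_quotient_of_krullDimLE_zero {I : Ideal R}
    (hdim : Ring.KrullDimLE 0 (R ⧸ I)) : IsFiniteLength R (R ⧸ I) := by
  rw [isFiniteLength_iff_isNoetherian_isArtinian]
  refine ⟨inferInstance, ?_⟩
  have : IsArtinianRing (R ⧸ I) := isArtinianRing_iff_krullDimLE_zero.mpr hdim
  exact isArtinian_of_surjective_algebraMap (R := R ⧸ I) Ideal.Quotient.mk_surjective

theorem isFiniteLength_quotient_of_forall_prime {I : Ideal R}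
    (h : ∀ p : Ideal R, p.IsPrime → I ≤ p → p = maximalIdeal R) :
    IsFiniteLength R (R ⧸ I) := by
  refine isFiniteLength_quotient_of_krullDimLE_zero ?_
  rw [Ring.krullDimLE_zero_iff]
  intro q hq
  have h1 := h (q.comap (Ideal.Quotient.mk I)) inferInstance (by
    intro x hx
    rw [Ideal.mem_comap, Ideal.Quotient.eq_zero_iff_mem.mpr hx]
    exact q.zero_mem)
  have h2 : (q.comap (Ideal.Quotient.mk I)).IsMaximal := h1 ▸ maximalIdeal.isMaximal R
  rcases Ideal.map_eq_top_or_isMaximal_of_surjective (Ideal.Quotient.mk I)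
    Ideal.Quotient.mk_surjective h2 with h3 | h3
  · rw [Ideal.map_comap_of_surjective _ Ideal.Quotient.mk_surjective] at h3
    exact absurd h3 hq.ne_top
  · rwa [Ideal.map_comap_of_surjective _ Ideal.Quotient.mk_surjective] at h3

omit [IsLocalRing R] [IsNoetherianRing R] in
theorem krullDimLE_zero_quotient_of_isFiniteLength {I : Ideal R} (h : IsFiniteLength R (R ⧸ I)) :
    Ring.KrullDimLE 0 (R ⧸ I) := by
  have h1 := (isFiniteLength_iff_isNoetherian_isArtinian.mp h).2
  have : IsArtinianRing (R ⧸ I) := isArtinian_of_tower R h1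
  infer_instance

omit [IsLocalRing R] [IsNoetherianRing R] in
theorem ringKrullDim_quotient_eq_zero {I : Ideal R} (hI : I ≠ ⊤)
    (h : IsFiniteLength R (R ⧸ I)) : ringKrullDim (R ⧸ I) = 0 := by
  have : Nontrivial (R ⧸ I) := Ideal.Quotient.nontrivial_iff.mpr hI
  have := krullDimLE_zero_quotient_of_isFiniteLength h
  exact ringKrullDimZero_iff_ringKrullDim_eq_zero.mp this

theorem isFiniteLength_quotient_ofList {ys : List R} (reg : IsRegular R ys)
    (hlen : ringKrullDim R = ys.length) : IsFiniteLength R (R ⧸ Ideal.ofList ys) := by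
  have h := ringKrullDim_add_length_eq_ringKrullDim_of_isRegular ys reg
  have hdim : ringKrullDim (R ⧸ Ideal.ofList ys) = 0 := by
    rw [hlen] at h
    exact ENat.WithBot.add_natCast_cancel.mp (h.trans (zero_add _).symm)
  have : Nontrivial (R ⧸ Ideal.ofList ys) := Ideal.Quotient.nontrivial_iff.mpr
    (ne_top_of_le_ne_top (maximalIdeal.isMaximal R).ne_top (mem_maximalIdeal_of_isRegular reg))
  exact isFiniteLength_quotient_of_krullDimLE_zero
    (ringKrullDimZero_iff_ringKrullDim_eq_zero.mpr hdim)

/-- A non-maximal minimal prime q of (ys) is associated, so R/q embeds in R/(ys). This is a nonzero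
element of Hom(R/q, R/(ys)) ≅ Ext^|ys|(R/q, R), which vanishes by the Nakayama argument. -/
theorem eq_maximalIdeal_of_isPrime_of_le {ys : List R} (reg : IsRegular R ys)
    (hvan : ∀ (M : Type u) [AddCommGroup M] [Module R M] [Module.Finite R M],
      Subsingleton (Ext (ModuleCat.of R M) (ModuleCat.of R R) (ys.length + 1)))
    (p : Ideal R) [p.IsPrime] (hp : Ideal.ofList ys ≤ p) : p = maximalIdeal R := by
  obtain ⟨q, hq, hqp⟩ := Ideal.exists_minimalPrimes_le hp
  have hqprime : q.IsPrime := hq.1.1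
  suffices h : q = maximalIdeal R from
    le_antisymm (le_maximalIdeal Ideal.IsPrime.ne_top') (h ▸ hqp)
  by_contra hne
  have hass : q ∈ associatedPrimes R (R ⧸ Ideal.ofList ys) := by
    refine Module.associatedPrimes.minimalPrimes_annihilator_subset_associatedPrimes R _ ?_
    rwa [Ideal.annihilator_quotient]
  obtain ⟨-, f, hf⟩ := (isAssociatedPrime_iff_exists_injective_linearMap _ _).mp hass
  have hsub := subsingleton_ext_quotient_prime (ModuleCat.of R R) ys.length hvan q hne
  obtain ⟨e⟩ := exists_ext_length_equiv_linearMap_quotient (R ⧸ q) ys reg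
    (by rw [Ideal.annihilator_quotient]; exact hq.1.2)
  have hsub' : Subsingleton ((R ⧸ q) →ₗ[R] (R ⧸ Ideal.ofList ys)) := e.symm.toEquiv.subsingleton
  have hf0 : f (Ideal.Quotient.mk q 1) = 0 := by rw [hsub'.elim f 0]; rfl
  have h1 := hf (hf0.trans (map_zero f).symm)
  rw [Ideal.Quotient.eq_zero_iff_mem] at h1
  exact hqprime.ne_top ((Ideal.eq_top_iff_one q).mpr h1)

omit [IsNoetherianRing R] in
theorem nonempty_equiv_residue_of_isSimpleModule (M : Type v) [AddCommGroup M] [Module R M]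
    [IsSimpleModule R M] : Nonempty (M ≃ₗ[R] (R ⧸ maximalIdeal R)) := by
  obtain ⟨n, hn, ⟨e⟩⟩ := isSimpleModule_iff_quot_maximal.mp ‹IsSimpleModule R M›
  rw [eq_maximalIdeal hn] at e
  exact ⟨e⟩

theorem subsingleton_ext_residue {ys : List R} (reg : IsRegular R ys) {i : ℕ}
    (hi : i < ys.length) :
    Subsingleton (Ext (ModuleCat.of R (R ⧸ maximalIdeal R)) (ModuleCat.of R R) i) := by
  refine ModuleCat.subsingleton_ext_of_exists_isRegular (maximalIdeal R)
    (ModuleCat.of R (R ⧸ maximalIdeal R)) ?_ (ModuleCat.of R R)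
    (ofList_smul_top_lt (maximalIdeal.isMaximal R).ne_top) ys
    (fun r hr => mem_maximalIdeal_of_isRegular reg (Ideal.subset_span hr)) reg i hi
  exact support_subset_zeroLocus_ofList (Ideal.annihilator_quotient (I := maximalIdeal R)).ge

theorem subsingleton_ext_of_isFiniteLength {ys : List R} (reg : IsRegular R ys) {i : ℕ}
    (hi : i < ys.length) {M : Type u} [AddCommGroup M] [Module R M] (hM : IsFiniteLength R M) :
    Subsingleton (Ext (ModuleCat.of R M) (ModuleCat.of R R) i) := by
  induction hM with
  | @of_subsingleton M => exact subsingleton_ext_of_subsingleton M _ i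
  | @of_simple_quotient M _ _ N _ _ ih =>
    obtain ⟨e⟩ := nonempty_equiv_residue_of_isSimpleModule (R := R) (M ⧸ N)
    exact subsingleton_ext_middle N.injective_subtype (LinearMap.exact_subtype_mkQ N)
      N.mkQ_surjective _ i ih (subsingleton_ext_congr e _ i (subsingleton_ext_residue reg hi))

omit [IsLocalRing R] [IsNoetherianRing R] in
theorem length_ext_congr {M M' : Type u} [AddCommGroup M] [Module R M] [AddCommGroup M']
    [Module R M'] (e : M ≃ₗ[R] M') (N : ModuleCat.{u} R) (i : ℕ) :
    Module.length R (Ext (ModuleCat.of R M) N i) =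
      Module.length R (Ext (ModuleCat.of R M') N i) := by
  refine LinearEquiv.length_eq (LinearEquiv.ofLinearMap
    ((Ext.mk₀ (ModuleCat.ofHom e.symm.toLinearMap)).precompOfLinear R N (zero_add i))
    ((Ext.mk₀ (ModuleCat.ofHom e.toLinearMap)).precompOfLinear R N (zero_add i)) ?_ ?_)
  · ext x
    change (Ext.mk₀ _).comp ((Ext.mk₀ _).comp x (zero_add i)) (zero_add i) = x
    rw [Ext.mk₀_comp_mk₀_assoc, ← ModuleCat.ofHom_comp]
    simp
  · ext x
    change (Ext.mk₀ _).comp ((Ext.mk₀ _).comp x (zero_add i)) (zero_add i) = x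
    rw [Ext.mk₀_comp_mk₀_assoc, ← ModuleCat.ofHom_comp]
    simp

/-- On finite length modules Ext vanishes just below and just above degree |ys|, so Ext in that
degree is exact and its length is counted by composition factors. -/
theorem length_ext_of_isFiniteLength {ys : List R} (reg : IsRegular R ys)
    (hvan : ∀ (M : Type u) [AddCommGroup M] [Module R M] [Module.Finite R M],
      Subsingleton (Ext (ModuleCat.of R M) (ModuleCat.of R R) (ys.length + 1)))
    {M : Type u} [AddCommGroup M] [Module R M] (hM : IsFiniteLength R M) :
    Module.length R (Ext (ModuleCat.of R M) (ModuleCat.of R R) ys.length) =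
      Module.length R M * Module.length R
        (Ext (ModuleCat.of R (R ⧸ maximalIdeal R)) (ModuleCat.of R R) ys.length) := by
  induction hM with
  | @of_subsingleton M =>
    have := subsingleton_ext_of_subsingleton M (ModuleCat.of R R) ys.length
    rw [Module.length_eq_zero, Module.length_eq_zero, zero_mul]
  | @of_simple_quotient M _ _ N _ hN ih =>
    obtain ⟨e⟩ := nonempty_equiv_residue_of_isSimpleModule (R := R) (M ⧸ N)
    have : Module.Finite R (M ⧸ N) := Module.Finite.equiv e.symm
    rw [length_ext_eq_add N.injective_subtype (LinearMap.exact_subtype_mkQ N)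
      N.mkQ_surjective _ ys.length
      (fun j hj => subsingleton_ext_of_isFiniteLength reg (by omega) hN) (hvan _), ih,
      length_ext_congr e, Module.length_eq_add_of_exact N.subtype N.mkQ N.injective_subtype
        N.mkQ_surjective (LinearMap.exact_subtype_mkQ N), Module.length_eq_one R (M ⧸ N),
      add_mul, one_mul, add_comm]

end Gorenstein

/-! ### Cyclic socles. -/

section Socle

open IsLocalRing

/-- The quotient of a local ring by `𝔞` has cyclic socle. -/
def HasCyclicSocle {R : Type u} [CommRing R] [IsLocalRing R] (𝔞 : Ideal R) : Prop :=
  ∃ a : R, (∀ r ∈ maximalIdeal R, r * a ∈ 𝔞) ∧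
    ∀ b : R, (∀ r ∈ maximalIdeal R, r * b ∈ 𝔞) → ∃ c : R, b - c * a ∈ 𝔞

/-- The map from the residue field determined by a socle element of `R ⧸ 𝔞`. -/
def socleMap {R : Type u} [CommRing R] [IsLocalRing R] {𝔞 : Ideal R} (b : R)
    (hb : ∀ r ∈ maximalIdeal R, r * b ∈ 𝔞) : (R ⧸ maximalIdeal R) →ₗ[R] (R ⧸ 𝔞) :=
  (maximalIdeal R).liftQ (LinearMap.toSpanSingleton R (R ⧸ 𝔞) (Ideal.Quotient.mk 𝔞 b))
    fun r hr => Ideal.Quotient.eq_zero_iff_mem.mpr (hb r hr)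

theorem HasCyclicSocle.of_length_le_one {R : Type u} [CommRing R] [IsLocalRing R] {𝔞 : Ideal R}
    (h : Module.length R ((R ⧸ maximalIdeal R) →ₗ[R] (R ⧸ 𝔞)) = 1) : HasCyclicSocle 𝔞 := by
  have := Module.length_eq_one_iff.mp h
  have hnt := IsSimpleModule.nontrivial R ((R ⧸ maximalIdeal R) →ₗ[R] (R ⧸ 𝔞))
  obtain ⟨f, hf⟩ := exists_ne (0 : (R ⧸ maximalIdeal R) →ₗ[R] (R ⧸ 𝔞))
  obtain ⟨a, ha⟩ := Ideal.Quotient.mk_surjective (f (Ideal.Quotient.mk _ 1))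
  have key : ∀ r, Ideal.Quotient.mk 𝔞 (r * a) = f (Ideal.Quotient.mk _ r) := by
    intro r
    rw [map_mul, ha]
    change r • f _ = _
    rw [← map_smul]
    congr 1
    change Ideal.Quotient.mk _ (r * 1) = _
    rw [mul_one]
  refine ⟨a, fun r hr => ?_, fun b hb => ?_⟩
  · rw [← Ideal.Quotient.eq_zero_iff_mem, key, Ideal.Quotient.eq_zero_iff_mem.mpr hr, map_zero]
  · obtain ⟨c, hc⟩ := (Submodule.mem_span_singleton.mp
      ((IsSimpleModule.span_singleton_eq_top R hf).ge (Submodule.mem_top (x := socleMap b hb))))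
    refine ⟨c, ?_⟩
    rw [← Ideal.Quotient.eq_zero_iff_mem, map_sub, sub_eq_zero, map_mul, ha]
    have := LinearMap.congr_fun hc (Ideal.Quotient.mk _ 1)
    change c • f _ = (1 : R) • Ideal.Quotient.mk 𝔞 b at this
    rw [one_smul] at this
    rw [← this]
    rfl

end Socle

/-! ### Gorenstein local rings: depth equals dimension, and parameter quotients have simple socle.
-/

namespace IsGorensteinLocalRing

open IsLocalRing Abelian

variable (R : Type u) [CommRing R] [IsGorensteinLocalRing R]

theorem exists_isRegular_subsingleton_ext : ∃ ys : List R, IsRegular R ys ∧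
    ringKrullDim R = ys.length ∧
    ∀ (M : Type u) [AddCommGroup M] [Module R M] [Module.Finite R M],
      Subsingleton (Ext (ModuleCat.of R M) (ModuleCat.of R R) (ys.length + 1)) := by
  obtain ⟨n, hn⟩ := exists_hasInjectiveDimensionLE (R := R)
  obtain ⟨ys, reg, hnt⟩ := exists_isRegular_nontrivial_linearMap_residue R
  have hvan : ∀ (M : Type u) [AddCommGroup M] [Module R M] [Module.Finite R M],
      Subsingleton (Ext (ModuleCat.of R M) (ModuleCat.of R R) (ys.length + 1)) :=
    fun M _ _ _ => subsingleton_ext_self_of_length_lt hn reg hnt (Nat.lt_succ_self _) M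
  refine ⟨ys, reg, ?_, hvan⟩
  have hfin := isFiniteLength_quotient_of_forall_prime (I := Ideal.ofList ys)
    fun p hp hle => eq_maximalIdeal_of_isPrime_of_le reg hvan p hle
  rw [← ringKrullDim_add_length_eq_ringKrullDim_of_isRegular ys reg,
    ringKrullDim_quotient_eq_zero (ne_top_of_le_ne_top (maximalIdeal.isMaximal R).ne_top
      (mem_maximalIdeal_of_isRegular reg)) hfin, zero_add]

variable {R}

/-- Count the length of Ext^d(R/(zs), R) twice. It is End(R/(zs)), of length λ(R/(zs)); by
composition factors it is λ(R/(zs)) times the length r of the socle. Cancelling the finite nonzero λ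
gives r = 1. -/
theorem hasCyclicSocle {zs : List R} (reg : IsRegular R zs) (hlen : ringKrullDim R = zs.length) :
    HasCyclicSocle (Ideal.ofList zs) := by
  obtain ⟨ys, -, hys, hvan⟩ := exists_isRegular_subsingleton_ext R
  have hyz : ys.length = zs.length := by
    rw [hys] at hlen
    exact_mod_cast hlen
  rw [hyz] at hvan
  have hfin := isFiniteLength_quotient_ofList reg hlen
  have hle := mem_maximalIdeal_of_isRegular reg
  have hA := length_ext_of_isFiniteLength reg hvan hfin
  obtain ⟨e⟩ := exists_ext_length_equiv_linearMap_quotient (R ⧸ Ideal.ofList zs) zs reg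
    (by rw [Ideal.annihilator_quotient])
  obtain ⟨e'⟩ := exists_ext_length_equiv_linearMap_quotient (R ⧸ maximalIdeal R) zs reg
    (by rw [Ideal.annihilator_quotient]; exact hle)
  have e2 : ((R ⧸ Ideal.ofList zs) →ₗ[R] (R ⧸ Ideal.ofList zs)) ≃ₗ[R] (R ⧸ Ideal.ofList zs) :=
    linearMapQuotientEquiv _ _ fun a ha n => by
      obtain ⟨n, rfl⟩ := Ideal.Quotient.mk_surjective n
      exact Ideal.Quotient.eq_zero_iff_mem.mpr (Ideal.mul_mem_right _ _ ha)
  rw [e.length_eq, e'.length_eq, e2.length_eq] at hA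
  refine HasCyclicSocle.of_length_le_one ?_
  have h1 := Module.length_ne_top_iff.mpr hfin
  have h2 : Module.length R (R ⧸ Ideal.ofList zs) ≠ 0 := by
    rw [Ne, Module.length_eq_zero_iff, not_subsingleton_iff_nontrivial]
    exact Ideal.Quotient.nontrivial_iff.mpr
      (ne_top_of_le_ne_top (maximalIdeal.isMaximal R).ne_top hle)
  generalize Module.length R (R ⧸ Ideal.ofList zs) = L at hA h1 h2
  lift L to ℕ using h1
  generalize Module.length R ((R ⧸ maximalIdeal R) →ₗ[R] (R ⧸ Ideal.ofList zs)) = r at hA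
  have h2' : L ≠ 0 := by exact_mod_cast h2
  induction r with
  | top => rw [ENat.mul_top h2] at hA; exact absurd hA (ENat.natCast_ne_top L)
  | coe r =>
    have hA' : L = L * r := by exact_mod_cast hA
    exact_mod_cast (Nat.eq_of_mul_eq_mul_left (Nat.pos_of_ne_zero h2')
      (hA'.symm.trans (mul_one L).symm))

theorem exists_isRegular_of_isFiniteLength {I : Ideal R} (hI : I ≠ ⊤)
    (hfin : IsFiniteLength R (R ⧸ I)) :
    ∃ ys : List R, IsRegular R ys ∧ ringKrullDim R = ys.length ∧ Ideal.ofList ys ≤ I := by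
  obtain ⟨ys, reg, hys, -⟩ := exists_isRegular_subsingleton_ext R
  obtain ⟨zs, hlen, hmem, regz⟩ := ModuleCat.exists_isRegular_of_exists_subsingleton_ext I
    ys.length (ModuleCat.of R R) (ofList_smul_top_lt hI) (ModuleCat.of R (R ⧸ I))
    (by rw [Module.support_eq_zeroLocus]; exact congrArg _ (congrArg _ Ideal.annihilator_quotient))
    (fun i hi => subsingleton_ext_of_isFiniteLength reg hi hfin)
  exact ⟨zs, regz, by rw [hlen, hys], Ideal.span_le.mpr hmem⟩

end IsGorensteinLocalRing

/-! ### Length inequalities. -/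

section Length

variable {R : Type u} [CommRing R] {M N P : Type*} [AddCommGroup M] [AddCommGroup N]
  [AddCommGroup P] [Module R M] [Module R N] [Module R P]

theorem exists_comp_eq_of_ker_le {f : M →ₗ[R] N} (hf : Function.Surjective f) (g : M →ₗ[R] P)
    (h : LinearMap.ker f ≤ LinearMap.ker g) : ∃ k : N →ₗ[R] P, k ∘ₗ f = g := by
  refine ⟨(LinearMap.ker f).liftQ g h ∘ₗ (f.quotKerEquivOfSurjective hf).symm.toLinearMap, ?_⟩
  ext x
  have : (f.quotKerEquivOfSurjective hf).symm (f x) = Submodule.Quotient.mk x := by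
    rw [LinearEquiv.symm_apply_eq]
    rfl
  simp [this]

theorem length_le_add_of_exact {f : N →ₗ[R] M} {g : M →ₗ[R] P} (h : Function.Exact f g) :
    Module.length R M ≤ Module.length R N + Module.length R P := by
  rw [Module.length_eq_add_of_exact (LinearMap.ker g).subtype g.rangeRestrict
    (Submodule.injective_subtype _) g.surjective_rangeRestrict (by
      intro x
      rw [Submodule.coe_subtype, Subtype.range_coe, SetLike.mem_coe, LinearMap.mem_ker]
      exact Subtype.ext_iff)]
  refine add_le_add ?_ (Module.length_le_of_injective _ (Submodule.injective_subtype _))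
  rw [h.linearMap_ker_eq]
  exact Module.length_le_of_surjective _ f.surjective_rangeRestrict

theorem surjective_of_injective_of_length_le {f : M →ₗ[R] N} (hf : Function.Injective f)
    (hle : Module.length R N ≤ Module.length R M) (hN : Module.length R N ≠ ⊤) :
    Function.Surjective f := by
  have h := Module.length_eq_add_of_exact f (LinearMap.range f).mkQ hf (Submodule.mkQ_surjective _)
    (LinearMap.exact_map_mkQ_range f)
  have hM : Module.length R M ≠ ⊤ :=
    ne_top_of_le_ne_top hN (Module.length_le_of_injective f hf)
  have h0 : Module.length R (N ⧸ LinearMap.range f) = 0 := by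
    rw [h] at hle
    have h1 : Module.length R M + Module.length R (N ⧸ LinearMap.range f) ≤
      Module.length R M + 0 := by rwa [add_zero]
    exact le_antisymm ((ENat.add_le_add_iff_left hM).mp h1) bot_le
  rw [Module.length_eq_zero_iff, Submodule.Quotient.subsingleton_iff] at h0
  exact LinearMap.range_eq_top.mp h0

theorem natCast_mul_ne_top (n : ℕ) {L : ℕ∞} (h : L ≠ ⊤) : (n : ℕ∞) * L ≠ ⊤ := by
  lift L to ℕ using h
  exact_mod_cast ENat.natCast_ne_top (n * L)

end Length

/-! ### Duality into a finite length quotient with cyclic socle. -/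

section Duality

open IsLocalRing

variable {R : Type u} [CommRing R] [IsLocalRing R] {𝔞 : Ideal R}

theorem HasCyclicSocle.length_linearMap_residue_le (hs : HasCyclicSocle 𝔞) :
    Module.length R ((R ⧸ maximalIdeal R) →ₗ[R] (R ⧸ 𝔞)) ≤ 1 := by
  obtain ⟨a, ha, hgen⟩ := hs
  let g : R →ₗ[R] ((R ⧸ maximalIdeal R) →ₗ[R] (R ⧸ 𝔞)) :=
    LinearMap.toSpanSingleton R _ (socleMap a ha)
  have hg : maximalIdeal R ≤ LinearMap.ker g := by
    intro r hr
    refine Submodule.linearMap_qext _ (LinearMap.ext_ring ?_)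
    change r • (1 : R) • Ideal.Quotient.mk 𝔞 a = 0
    rw [one_smul]
    exact Ideal.Quotient.eq_zero_iff_mem.mpr (ha r hr)
  have hsurj : Function.Surjective ((maximalIdeal R).liftQ g hg) := by
    intro f
    obtain ⟨b, hb⟩ := Ideal.Quotient.mk_surjective (f (Ideal.Quotient.mk _ 1))
    have key : ∀ r, Ideal.Quotient.mk 𝔞 (r * b) = f (Ideal.Quotient.mk _ r) := by
      intro r
      rw [map_mul, hb]
      change r • f _ = _
      rw [← map_smul]
      congr 1
      change Ideal.Quotient.mk _ (r * 1) = _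
      rw [mul_one]
    obtain ⟨c, hc⟩ := hgen b fun r hr => by
      rw [← Ideal.Quotient.eq_zero_iff_mem, key, Ideal.Quotient.eq_zero_iff_mem.mpr hr, map_zero]
    refine ⟨Ideal.Quotient.mk _ c, Submodule.linearMap_qext _ (LinearMap.ext_ring ?_)⟩
    change c • (1 : R) • Ideal.Quotient.mk 𝔞 a = f (Ideal.Quotient.mk _ 1)
    rw [one_smul, ← hb]
    exact (Ideal.Quotient.eq.mpr hc).symm
  have : IsSimpleModule R (R ⧸ maximalIdeal R) :=
    isSimpleModule_iff_quot_maximal.mpr ⟨_, maximalIdeal.isMaximal R, ⟨LinearEquiv.refl _ _⟩⟩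
  exact (Module.length_le_of_surjective _ hsurj).trans (Module.length_eq_one R _).le

theorem HasCyclicSocle.length_linearMap_le (hs : HasCyclicSocle 𝔞) {M : Type v} [AddCommGroup M]
    [Module R M] (hM : IsFiniteLength R M) :
    Module.length R (M →ₗ[R] (R ⧸ 𝔞)) ≤ Module.length R M := by
  induction hM with
  | @of_subsingleton M =>
    have : Subsingleton (M →ₗ[R] (R ⧸ 𝔞)) :=
      ⟨fun f g => LinearMap.ext fun x => by rw [Subsingleton.elim x 0, map_zero, map_zero]⟩
    rw [Module.length_eq_zero]
    exact bot_le
  | @of_simple_quotient M _ _ N _ hN ih =>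
    obtain ⟨e⟩ := nonempty_equiv_residue_of_isSimpleModule (R := R) (M ⧸ N)
    refine (length_le_add_of_exact (LinearMap.exact_lcomp_of_exact_of_surjective (R ⧸ 𝔞)
      (LinearMap.exact_subtype_mkQ N) N.mkQ_surjective)).trans ?_
    rw [Module.length_eq_add_of_exact N.subtype N.mkQ N.injective_subtype
        N.mkQ_surjective (LinearMap.exact_subtype_mkQ N), add_comm]
    refine add_le_add ih ?_
    rw [(LinearEquiv.congrLeft (R ⧸ 𝔞) R e).length_eq, Module.length_eq_one R (M ⧸ N)]
    exact hs.length_linearMap_residue_le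

omit [IsLocalRing R] in
theorem smul_quotient_eq_zero {a : R} (ha : a ∈ 𝔞) (x : R ⧸ 𝔞) : a • x = 0 := by
  obtain ⟨x, rfl⟩ := Ideal.Quotient.mk_surjective x
  exact Ideal.Quotient.eq_zero_iff_mem.mpr (Ideal.mul_mem_right _ _ ha)

omit [IsLocalRing R] in
theorem exists_surjective_pi_quotient (𝔞 : Ideal R) {M : Type v} [AddCommGroup M]
    [Module R M] [Module.Finite R M] (h𝔞 : ∀ a ∈ 𝔞, ∀ x : M, a • x = 0) :
    ∃ (n : ℕ) (g : (Fin n → R ⧸ 𝔞) →ₗ[R] M), Function.Surjective g := by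
  obtain ⟨n, f, hf⟩ := Module.Finite.exists_fin' R M
  refine ⟨n, LinearMap.lsum R (fun _ => R ⧸ 𝔞) R fun i =>
    (linearMapQuotientEquiv 𝔞 M h𝔞).symm (f (Pi.single i 1)), fun x => ?_⟩
  obtain ⟨v, rfl⟩ := hf x
  refine ⟨fun i => Ideal.Quotient.mk 𝔞 (v i), ?_⟩
  rw [LinearMap.lsum_apply, LinearMap.sum_apply]
  conv_rhs => rw [LinearMap.pi_apply_eq_sum_univ f v]
  refine Finset.sum_congr rfl fun i _ => ?_
  change v i • f (Pi.single i 1) = _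
  congr 2
  ext j
  simp [Pi.single_apply, eq_comm]

omit [IsLocalRing R] in
theorem isFiniteLength_of_annihilator (hfin : IsFiniteLength R (R ⧸ 𝔞)) {M : Type v}
    [AddCommGroup M] [Module R M] [Module.Finite R M] (h𝔞 : ∀ a ∈ 𝔞, ∀ x : M, a • x = 0) :
    IsFiniteLength R M := by
  obtain ⟨n, g, hg⟩ := exists_surjective_pi_quotient 𝔞 h𝔞
  rw [← Module.length_ne_top_iff] at hfin ⊢
  refine ne_top_of_le_ne_top ?_ (Module.length_le_of_surjective g hg)
  rw [Module.length_pi_of_fintype]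
  simpa using natCast_mul_ne_top n hfin

/-- The upper bound comes from composition factors. For the lower one, present M by a free
R/𝔞-module with kernel K: the free module has a dual of its own length, the dual of K is no longer
than K, and subtracting leaves at least λ(M). Injectivity of R/𝔞 over itself is never invoked. -/
theorem HasCyclicSocle.length_linearMap_eq (hs : HasCyclicSocle 𝔞)
    (hfin : IsFiniteLength R (R ⧸ 𝔞)) {M : Type v} [AddCommGroup M]
    [Module R M] [Module.Finite R M] (h𝔞 : ∀ a ∈ 𝔞, ∀ x : M, a • x = 0) :
    Module.length R (M →ₗ[R] (R ⧸ 𝔞)) = Module.length R M := by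
  refine le_antisymm (hs.length_linearMap_le (isFiniteLength_of_annihilator hfin h𝔞)) ?_
  obtain ⟨n, g, hg⟩ := exists_surjective_pi_quotient 𝔞 h𝔞
  have hex : Function.Exact (LinearMap.ker g).subtype g := g.exact_subtype_ker_map
  have h1 := Module.length_eq_add_of_exact (LinearMap.ker g).subtype g
    (Submodule.injective_subtype _) hg hex
  have h2 := length_le_add_of_exact (LinearMap.exact_lcomp_of_exact_of_surjective (R ⧸ 𝔞) hex hg)
  have h3 : Module.length R ((Fin n → R ⧸ 𝔞) →ₗ[R] (R ⧸ 𝔞)) =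
      Module.length R (Fin n → R ⧸ 𝔞) := by
    refine LinearEquiv.length_eq ((LinearMap.lsum R (fun _ => R ⧸ 𝔞) R).symm.trans
      (LinearEquiv.piCongrRight fun _ => linearMapQuotientEquiv 𝔞 (R ⧸ 𝔞)
        fun a ha x => smul_quotient_eq_zero ha x))
  have h4 : Module.length R (Fin n → R ⧸ 𝔞) ≠ ⊤ := by
    rw [Module.length_pi_of_fintype]
    simpa using natCast_mul_ne_top n (Module.length_ne_top_iff.mpr hfin)
  have h5 : Module.length R (LinearMap.ker g) ≠ ⊤ :=
    ne_top_of_le_ne_top h4 (Module.length_le_of_injective _ (Submodule.injective_subtype _))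
  have h6 := hs.length_linearMap_le (Module.length_ne_top_iff.mp h5)
  rw [h3, h1, add_comm] at h2
  exact (ENat.add_le_add_iff_right h5).mp (h2.trans (add_le_add_right h6 _))

/-- If every functional kills x, all functionals factor through M/⟨x⟩, so M and M/⟨x⟩ have equal
length and x = 0. Surjectivity follows because M and its double dual have the same finite length. -/
theorem HasCyclicSocle.bijective_applyₗ [IsNoetherianRing R] (hs : HasCyclicSocle 𝔞)
    (hfin : IsFiniteLength R (R ⧸ 𝔞)) {M : Type v} [AddCommGroup M]
    [Module R M] [Module.Finite R M] (h𝔞 : ∀ a ∈ 𝔞, ∀ x : M, a • x = 0) :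
    Function.Bijective (LinearMap.applyₗ : M →ₗ[R] (M →ₗ[R] (R ⧸ 𝔞)) →ₗ[R] (R ⧸ 𝔞)) := by
  have hM : Module.length R M ≠ ⊤ :=
    Module.length_ne_top_iff.mpr (isFiniteLength_of_annihilator hfin h𝔞)
  have hinj : Function.Injective
      (LinearMap.applyₗ : M →ₗ[R] (M →ₗ[R] (R ⧸ 𝔞)) →ₗ[R] (R ⧸ 𝔞)) := by
    rw [injective_iff_map_eq_zero]
    intro x hx
    let K : Submodule R M := Submodule.span R {x}
    have hsurj : Function.Surjective (LinearMap.lcomp R (R ⧸ 𝔞) K.mkQ) := by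
      intro φ
      refine exists_comp_eq_of_ker_le K.mkQ_surjective φ ?_
      rw [Submodule.ker_mkQ, Submodule.span_singleton_le_iff_mem]
      exact LinearMap.congr_fun hx φ
    have h1 := Module.length_le_of_surjective _ hsurj
    rw [hs.length_linearMap_eq hfin h𝔞, hs.length_linearMap_eq hfin (M := M ⧸ K) (by
      intro a ha y
      obtain ⟨y, rfl⟩ := K.mkQ_surjective y
      rw [← map_smul, h𝔞 a ha, map_zero]),
      Module.length_eq_add_of_exact K.subtype K.mkQ K.injective_subtype
        K.mkQ_surjective (LinearMap.exact_subtype_mkQ K)] at h1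
    have h2 : Module.length R (M ⧸ K) ≠ ⊤ :=
      ne_top_of_le_ne_top hM (Module.length_le_of_surjective _ K.mkQ_surjective)
    have h3 : Module.length R K = 0 := by
      refine le_antisymm ((ENat.add_le_add_iff_right h2).mp (h1.trans (zero_add _).ge)) bot_le
    rw [Module.length_eq_zero_iff, Submodule.subsingleton_iff_eq_bot,
      Submodule.span_singleton_eq_bot] at h3
    exact h3
  have hlen : Module.length R ((M →ₗ[R] (R ⧸ 𝔞)) →ₗ[R] (R ⧸ 𝔞)) = Module.length R M := by
    rw [hs.length_linearMap_eq hfin, hs.length_linearMap_eq hfin h𝔞]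
    intro a ha φ
    ext x
    exact smul_quotient_eq_zero ha _
  exact ⟨hinj, surjective_of_injective_of_length_le hinj hlen.le (hlen ▸ hM)⟩

end Duality

/-! ### The twisted conormal module as a dual. -/

section Conormal

open TensorProduct

variable {R : Type u} [CommRing R]

theorem smul_cotangent_eq_zero {I : Ideal R} {a : R} (ha : a ∈ I) (x : I.Cotangent) :
    a • x = 0 := by
  obtain ⟨x, rfl⟩ := I.toCotangent_surjective x
  rw [← map_smul, Ideal.toCotangent_eq_zero]
  change a * (x : R) ∈ I ^ 2
  rw [pow_two]
  exact Ideal.mul_mem_mul ha x.2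

theorem bijective_lcomp_toCotangent (I : Ideal R) (N : Type v) [AddCommGroup N] [Module R N]
    (hN : ∀ a ∈ I, ∀ n : N, a • n = 0) :
    Function.Bijective (LinearMap.lcomp R N I.toCotangent) := by
  refine ⟨LinearMap.lcomp_injective_of_surjective _ I.toCotangent_surjective, fun φ => ?_⟩
  refine exists_comp_eq_of_ker_le I.toCotangent_surjective φ ?_
  intro x hx
  rw [LinearMap.mem_ker, Ideal.toCotangent_eq_zero] at hx
  have key : ∀ z (hz : z ∈ I ^ 2), φ ⟨z, Ideal.pow_le_self two_ne_zero hz⟩ = 0 := by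
    intro z hz
    rw [pow_two] at hz
    induction hz using Submodule.mul_induction_on' with
    | mem_mul_mem a ha b hb =>
      have : (⟨a * b, I.mul_mem_left a hb⟩ : I) = a • ⟨b, hb⟩ := rfl
      rw [this, map_smul, hN a ha]
    | add x hx y hy h1 h2 =>
      have hx' := Ideal.mul_le_left (I := I) (J := I) hx
      have hy' := Ideal.mul_le_left (I := I) (J := I) hy
      have : (⟨x + y, I.add_mem hx' hy'⟩ : I) = ⟨x, hx'⟩ + ⟨y, hy'⟩ := rfl
      rw [this, map_add, h1 (by rwa [pow_two]), h2 (by rwa [pow_two]), add_zero]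
  exact key x hx

theorem exists_quotCanonicalModule_equiv [IsNoetherianRing R] {I : Ideal R} {ys : List R}
    (reg : IsRegular R ys) (hle : Ideal.ofList ys ≤ I) (hh : I.height.toNat = ys.length) :
    Nonempty (QuotCanonicalModule I ≃ₗ[R] ((R ⧸ I) →ₗ[R] (R ⧸ Ideal.ofList ys))) := by
  have h := exists_ext_length_equiv_linearMap_quotient (R ⧸ I) ys reg
    (by rw [Ideal.annihilator_quotient]; exact hle)
  rw [← hh] at h
  exact h

/-- Dualize into R/(ys), which preserves length. By adjunction the dual of (I/I²) ⊗ ω is Hom(I/I², ω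
dual), and reflexivity turns the dual of ω = Hom(R/I, R/(ys)) into R/I. Only the cyclic socle is
assumed, so the result also serves rings not known to be Gorenstein. -/
theorem length_twistedConormal [IsLocalRing R] [IsNoetherianRing R] {I : Ideal R} {ys : List R}
    (reg : IsRegular R ys) (hle : Ideal.ofList ys ≤ I) (hh : I.height.toNat = ys.length)
    (hs : HasCyclicSocle (Ideal.ofList ys))
    (hfin : IsFiniteLength R (R ⧸ Ideal.ofList ys)) :
    Module.length R (TwistedConormal I) = Module.length R (I →ₗ[R] (R ⧸ I)) := by
  obtain ⟨e⟩ := exists_quotCanonicalModule_equiv reg hle hh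
  have hfinω : Module.Finite R (QuotCanonicalModule I) := Module.Finite.equiv e.symm
  have hcot : Module.Finite R I.Cotangent :=
    Module.Finite.of_surjective I.toCotangent I.toCotangent_surjective
  have : TensorProduct.CompatibleSMul R (R ⧸ I) I.Cotangent (QuotCanonicalModule I) :=
    ⟨fun a m n => by
      obtain ⟨r, rfl⟩ := Ideal.Quotient.mk_surjective a
      change (algebraMap R (R ⧸ I) r • m) ⊗ₜ[R] n = m ⊗ₜ[R] (algebraMap R (R ⧸ I) r • n)
      rw [algebraMap_smul, algebraMap_smul, TensorProduct.smul_tmul]⟩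
  have e1 : TwistedConormal I ≃ₗ[R] TensorProduct R I.Cotangent (QuotCanonicalModule I) :=
    TensorProduct.equivOfCompatibleSMul R (R ⧸ I) R I.Cotangent (QuotCanonicalModule I)
  have e2 := LinearEquiv.ofBijective _ (hs.bijective_applyₗ hfin (M := R ⧸ I)
    fun a ha x => smul_quotient_eq_zero (hle ha) x)
  have e3 := LinearEquiv.ofBijective _ (bijective_lcomp_toCotangent I (R ⧸ I)
    fun a ha x => smul_quotient_eq_zero ha x)
  have e4 : (TensorProduct R I.Cotangent (QuotCanonicalModule I) →ₗ[R] (R ⧸ Ideal.ofList ys))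
      ≃ₗ[R] (I →ₗ[R] (R ⧸ I)) :=
    (TensorProduct.lift.equiv (RingHom.id R) I.Cotangent (QuotCanonicalModule I)
      (R ⧸ Ideal.ofList ys)).symm.trans
    ((LinearEquiv.congrRight ((LinearEquiv.congrLeft _ R e).trans e2.symm)).trans e3)
  rw [e1.length_eq, ← hs.length_linearMap_eq hfin, e4.length_eq]
  intro a ha x
  induction x with
  | zero => rw [smul_zero]
  | add x y hx hy => rw [smul_add, hx, hy, add_zero]
  | tmul x y =>
    rw [TensorProduct.smul_tmul', smul_cotangent_eq_zero (hle ha), TensorProduct.zero_tmul]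

end Conormal

/-! ### Maps out of an ideal generated by a regular sequence. -/

section RegularSequenceConormal

variable {R : Type u} [CommRing R]

theorem exists_sum_eq_of_mem_span_image (x : ℕ → R) (n : ℕ) {r : R}
    (hr : r ∈ Ideal.span (x '' Set.Iio n)) :
    ∃ c : ℕ → R, r = ∑ i ∈ Finset.range n, c i * x i := by
  have hset : Set.Iio n = ((Finset.range n : Finset ℕ) : Set ℕ) := by ext; simp
  rw [hset] at hr
  obtain ⟨c, hc⟩ := Submodule.mem_span_image_finset_iff_exists_fun R |>.mp hr
  refine ⟨fun i => if h : i ∈ Finset.range n then c ⟨i, h⟩ else 0, ?_⟩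
  rw [← hc, ← Finset.sum_attach (Finset.range n), Finset.univ_eq_attach]
  exact Finset.sum_congr rfl fun i _ => by simp

/-- This is the freeness of (x)/(x)² over R/(x), proved without the Koszul complex. -/
theorem mem_span_of_sum_mul_eq_zero (x : ℕ → R) (n : ℕ)
    (hx : ∀ i < n, ∀ r : R, r * x i ∈ Ideal.span (x '' Set.Iio i) →
      r ∈ Ideal.span (x '' Set.Iio i))
    (r : ℕ → R) (hr : ∑ i ∈ Finset.range n, r i * x i = 0) :
    ∀ i < n, r i ∈ Ideal.span (x '' Set.Iio n) := by
  induction n generalizing r with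
  | zero => intro i hi; omega
  | succ n ih =>
    have hmono : Ideal.span (x '' Set.Iio n) ≤ Ideal.span (x '' Set.Iio (n + 1)) :=
      Ideal.span_mono (Set.image_mono (Set.Iio_subset_Iio (Nat.le_succ n)))
    rw [Finset.sum_range_succ] at hr
    have hsum : ∀ c : ℕ → R, ∑ i ∈ Finset.range n, c i * x i ∈ Ideal.span (x '' Set.Iio n) :=
      fun c => Ideal.sum_mem _ fun i hi => Ideal.mul_mem_left _ _
        (Ideal.subset_span ⟨i, Finset.mem_range.mp hi, rfl⟩)
    have hn : r n ∈ Ideal.span (x '' Set.Iio n) := by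
      refine hx n (Nat.lt_succ_self n) _ ?_
      rw [← neg_eq_of_add_eq_zero_right hr]
      exact neg_mem (hsum r)
    obtain ⟨c, hc⟩ := exists_sum_eq_of_mem_span_image x n hn
    -- Substituting r n = ∑ c i * x i turns the relation into one among the first n elements, with
    -- these coefficients; the correction c i * x n lies in the larger ideal anyway.
    have h := ih (fun i hi => hx i (hi.trans (Nat.lt_succ_self n))) (fun i => r i + c i * x n) (by
      rw [← hr, hc, Finset.sum_mul, ← Finset.sum_add_distrib]
      exact Finset.sum_congr rfl fun i _ => by ring)
    intro i hi
    rcases Nat.lt_succ_iff_lt_or_eq.mp hi with hi | rfl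
    · have h1 : c i * x n ∈ Ideal.span (x '' Set.Iio (n + 1)) :=
        Ideal.mul_mem_left _ _ (Ideal.subset_span ⟨n, Nat.lt_succ_self n, rfl⟩)
      have h2 := (Ideal.span (x '' Set.Iio (n + 1))).sub_mem (hmono (h i hi)) h1
      simpa using h2
    · exact hmono hn

theorem span_image_getD_eq_ofList_take (xs : List R) {n : ℕ} (hn : n ≤ xs.length) :
    Ideal.span ((fun i => xs.getD i 0) '' Set.Iio n) = Ideal.ofList (xs.take n) := by
  refine congrArg Ideal.span (Set.ext fun y => ?_)
  simp only [Set.mem_image, Set.mem_Iio, Set.mem_ofPred_eq, List.mem_take_iff_getElem]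
  constructor
  · rintro ⟨i, hi, rfl⟩
    exact ⟨i, by omega, by rw [List.getD_eq_getElem _ _ (by omega)]⟩
  · rintro ⟨i, hi, rfl⟩
    exact ⟨i, by omega, by rw [List.getD_eq_getElem _ _ (by omega)]⟩

/-- Evaluation of linear maps on the generators of `Ideal.ofList xs`. -/
def evalOfList (xs : List R) (N : Type v) [AddCommGroup N] [Module R N] :
    (Ideal.ofList xs →ₗ[R] N) →ₗ[R] (Fin xs.length → N) :=
  LinearMap.pi fun i => LinearMap.applyₗ ⟨xs[i], Ideal.subset_span (xs.getElem_mem i.2)⟩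

theorem injective_evalOfList (xs : List R) (N : Type v) [AddCommGroup N] [Module R N] :
    Function.Injective (evalOfList xs N) := by
  rw [injective_iff_map_eq_zero]
  intro φ hφ
  ext ⟨y, hy⟩
  change φ ⟨y, hy⟩ = 0
  induction hy using Submodule.span_induction with
  | mem y hy =>
    obtain ⟨i, hi, rfl⟩ := List.getElem_of_mem hy
    exact congrFun hφ ⟨i, hi⟩
  | zero => exact map_zero φ
  | add y z hy hz h1 h2 =>
    have : (⟨y + z, add_mem hy hz⟩ : Ideal.ofList xs) = ⟨y, hy⟩ + ⟨z, hz⟩ := rfl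
    rw [this, map_add, h1, h2, add_zero]
  | smul a y hy h1 =>
    have : (⟨a • y, Submodule.smul_mem _ a hy⟩ : Ideal.ofList xs) = a • ⟨y, hy⟩ := rfl
    rw [this, map_smul, h1, smul_zero]

/-- Prescribed values on the generators are consistent because every relation has coefficients in
(xs), which kills N. -/
theorem surjective_evalOfList {xs : List R} (reg : IsWeaklyRegular R xs) (N : Type v)
    [AddCommGroup N] [Module R N] (hN : ∀ a ∈ Ideal.ofList xs, ∀ n : N, a • n = 0) :
    Function.Surjective (evalOfList xs N) := by
  intro v
  have hspan := span_image_getD_eq_ofList_take xs le_rfl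
  rw [List.take_length] at hspan
  let x : Fin xs.length → Ideal.ofList xs :=
    fun i => ⟨xs[i], Ideal.subset_span (xs.getElem_mem i.2)⟩
  let f : (Fin xs.length → R) →ₗ[R] Ideal.ofList xs := Fintype.linearCombination R x
  let g : (Fin xs.length → R) →ₗ[R] N := Fintype.linearCombination R v
  have hf : Function.Surjective f := by
    rintro ⟨y, hy⟩
    have hy' := hy
    rw [← hspan] at hy'
    obtain ⟨c, hc⟩ := exists_sum_eq_of_mem_span_image _ _ hy'
    refine ⟨fun i => c i, Subtype.ext ?_⟩
    change ((Fintype.linearCombination R x fun i => c i : Ideal.ofList xs) : R) = y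
    rw [hc, Fintype.linearCombination_apply, Finset.sum_range]
    simp [x]
  have hker : LinearMap.ker f ≤ LinearMap.ker g := by
    intro r hr
    have hr' : ∑ i, r i * xs[i] = 0 := by
      have := congrArg Subtype.val hr
      change ((Fintype.linearCombination R x r : Ideal.ofList xs) : R) = 0 at this
      rw [Fintype.linearCombination_apply] at this
      simpa [x] using this
    have key := mem_span_of_sum_mul_eq_zero (fun i => xs.getD i 0) xs.length (by
      intro i hi r hri
      rw [span_image_getD_eq_ofList_take xs hi.le] at hri ⊢
      have h1 := reg.regular_mod_prev i hi
      rw [isSMulRegular_quotient_iff_mem_of_smul_mem] at h1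
      rw [List.getD_eq_getElem _ _ hi] at hri
      have h2 := h1 r (by simpa [mul_comm] using hri)
      simpa using h2) (fun i => if h : i < xs.length then r ⟨i, h⟩ else 0) (by
      rw [Finset.sum_range, ← hr']
      exact Finset.sum_congr rfl fun i _ => by simp)
    rw [hspan] at key
    rw [LinearMap.mem_ker]
    change Fintype.linearCombination R v r = 0
    rw [Fintype.linearCombination_apply]
    refine Finset.sum_eq_zero fun i _ => hN _ ?_ _
    simpa using key i i.2
  obtain ⟨k, hk⟩ := exists_comp_eq_of_ker_le hf g hker
  refine ⟨k, funext fun i => ?_⟩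
  have := LinearMap.congr_fun hk (Pi.single i 1)
  have h1 : f (Pi.single i 1) = x i := by simp [f]
  have h2 : g (Pi.single i 1) = v i := by simp [g]
  rw [LinearMap.comp_apply, h1, h2] at this
  exact this

theorem length_linearMap_ofList {xs : List R} (reg : IsWeaklyRegular R xs) (N : Type v)
    [AddCommGroup N] [Module R N] (hN : ∀ a ∈ Ideal.ofList xs, ∀ n : N, a • n = 0) :
    Module.length R (Ideal.ofList xs →ₗ[R] N) = xs.length * Module.length R N := by
  rw [(LinearEquiv.ofBijective _ ⟨injective_evalOfList xs N,
    surjective_evalOfList reg N hN⟩).length_eq, Module.length_pi_of_fintype]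
  simp

end RegularSequenceConormal

/-! ### Linkage and first-order flag deformations. -/

section Linkage

variable {R : Type u} [CommRing R]

theorem exists_comp_eq_of_range_le {M N P : Type*} [AddCommGroup M] [AddCommGroup N]
    [AddCommGroup P] [Module R M] [Module R N] [Module R P] {f : N →ₗ[R] P}
    (hf : Function.Injective f) (g : M →ₗ[R] P) (h : ∀ x, g x ∈ LinearMap.range f) :
    ∃ k : M →ₗ[R] N, f ∘ₗ k = g := by
  refine ⟨(LinearEquiv.ofInjective f hf).symm.toLinearMap ∘ₗ g.codRestrict _ h, ?_⟩
  ext x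
  have := (LinearEquiv.ofInjective f hf).apply_symm_apply (g.codRestrict _ h x)
  exact congrArg Subtype.val this

theorem length_le_of_range_le {M N P : Type*} [AddCommGroup M] [AddCommGroup N]
    [AddCommGroup P] [Module R M] [Module R N] [Module R P] {f : M →ₗ[R] P} {g : N →ₗ[R] P}
    (hf : Function.Injective f) (h : LinearMap.range f ≤ LinearMap.range g) :
    Module.length R M ≤ Module.length R N :=
  calc Module.length R M = Module.length R (LinearMap.range f) :=
        (LinearEquiv.ofInjective f hf).length_eq
    _ ≤ Module.length R (LinearMap.range g) :=
        Module.length_le_of_injective _ (Submodule.inclusion_injective h)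
    _ ≤ Module.length R N := Module.length_le_of_surjective _ g.surjective_rangeRestrict

variable {F I J : Ideal R}

/-- Multiplication `R ⧸ I → Hom(J, R ⧸ F)` for ideals with `I * J ≤ F`. -/
def mulQuotientHom (h : ∀ x ∈ I, ∀ y ∈ J, x * y ∈ F) : (R ⧸ I) →ₗ[R] (J →ₗ[R] (R ⧸ F)) :=
  I.liftQ (LinearMap.toSpanSingleton R _ (F.mkQ ∘ₗ J.subtype)) fun x hx =>
    LinearMap.ext fun y => Ideal.Quotient.eq_zero_iff_mem.mpr (h x hx y y.2)

theorem mulQuotientHom_factor (h : ∀ x ∈ I, ∀ y ∈ J, x * y ∈ F) (hFI : F ≤ I) (a : R ⧸ F)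
    (y : J) : mulQuotientHom h (Submodule.factor hFI a) y = (y : R) • a := by
  obtain ⟨a, rfl⟩ := Ideal.Quotient.mk_surjective a
  change Ideal.Quotient.mk F (a * y) = Ideal.Quotient.mk F (y * a)
  rw [mul_comm]

theorem mulQuotientHom_apply_mem (h : ∀ x ∈ I, ∀ y ∈ J, x * y ∈ F) (a : R ⧸ I) {f : R}
    (hfF : f ∈ F) (hf : f ∈ J) : mulQuotientHom h a ⟨f, hf⟩ = 0 := by
  obtain ⟨a, rfl⟩ := Ideal.Quotient.mk_surjective a
  exact Ideal.Quotient.eq_zero_iff_mem.mpr (F.mul_mem_left a hfF)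

theorem injective_mulQuotientHom (h : ∀ x ∈ I, ∀ y ∈ J, x * y ∈ F)
    (hI : ∀ r : R, (∀ y ∈ J, r * y ∈ F) → r ∈ I) : Function.Injective (mulQuotientHom h) := by
  rw [injective_iff_map_eq_zero]
  intro a ha
  obtain ⟨a, rfl⟩ := Ideal.Quotient.mk_surjective a
  refine Ideal.Quotient.eq_zero_iff_mem.mpr (hI a fun y hy => ?_)
  exact Ideal.Quotient.eq_zero_iff_mem.mp (LinearMap.congr_fun ha ⟨y, hy⟩)

/-- First-order data for the flag `F ≤ I`: compatible pairs in `Hom(F, R ⧸ F) × Hom(I, R ⧸ I)`. -/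
def flagHom (hFI : F ≤ I) : Submodule R ((F →ₗ[R] (R ⧸ F)) × (I →ₗ[R] (R ⧸ I))) where
  carrier := {p | ∀ f : F, Submodule.factor hFI (p.1 f) = p.2 (Submodule.inclusion hFI f)}
  add_mem' {p q} hp hq f := by
    change Submodule.factor hFI (p.1 f + q.1 f) = p.2 _ + q.2 _
    rw [map_add, hp f, hq f]
  zero_mem' f := map_zero _
  smul_mem' c p hp f := by
    change Submodule.factor hFI (c • p.1 f) = c • p.2 _
    rw [map_smul, hp f]

theorem length_ker_factor_add (hFI : F ≤ I) :
    Module.length R (LinearMap.ker (Submodule.factor hFI)) + Module.length R (R ⧸ I) =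
      Module.length R (R ⧸ F) :=
  (Module.length_eq_add_of_exact (LinearMap.ker (Submodule.factor hFI)).subtype
    (Submodule.factor hFI) (Submodule.injective_subtype _) (Submodule.factor_surjective hFI)
    (Submodule.factor hFI).exact_subtype_ker_map).symm

/-- Project a pair to its second component. This is onto, since values on the regular generators of
F can be lifted from R/I to R/F at will; the kernel is Hom(F, I/F). -/
theorem length_flagHom {xs : List R} (reg : IsWeaklyRegular R xs) (hFI : Ideal.ofList xs ≤ I) :
    Module.length R (flagHom hFI) = xs.length *
      Module.length R (LinearMap.ker (Submodule.factor hFI)) +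
        Module.length R (I →ₗ[R] (R ⧸ I)) := by
  let K := LinearMap.ker (Submodule.factor hFI)
  rw [← length_linearMap_ofList reg K fun a ha n => Subtype.ext (smul_quotient_eq_zero ha _)]
  let i : (Ideal.ofList xs →ₗ[R] K) →ₗ[R] flagHom hFI :=
    LinearMap.codRestrict (flagHom hFI) ((LinearMap.inl R _ _) ∘ₗ (K.subtype.compRight R))
      fun φ f => (φ f).2
  let p : flagHom hFI →ₗ[R] (I →ₗ[R] (R ⧸ I)) := LinearMap.snd R _ _ ∘ₗ (flagHom hFI).subtype
  refine Module.length_eq_add_of_exact i p ?_ ?_ ?_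
  · rw [injective_iff_map_eq_zero]
    intro φ hφ
    ext f
    have h1 := congrArg (fun z : flagHom hFI => z.1.1 f) hφ
    exact h1
  · intro β
    obtain ⟨α, hα⟩ := surjective_evalOfList reg (R ⧸ Ideal.ofList xs)
      (fun a ha n => smul_quotient_eq_zero ha n) fun i =>
        (Submodule.factor_surjective hFI (β (Submodule.inclusion hFI
          ⟨xs[i], Ideal.subset_span (xs.getElem_mem i.2)⟩))).choose
    have hcomp : Submodule.factor hFI ∘ₗ α = β ∘ₗ Submodule.inclusion hFI := by
      apply injective_evalOfList
      funext i
      change Submodule.factor hFI (evalOfList xs _ α i) = _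
      rw [hα]
      exact (Submodule.factor_surjective hFI (β (Submodule.inclusion hFI
          ⟨xs[i], Ideal.subset_span (xs.getElem_mem i.2)⟩))).choose_spec
    exact ⟨⟨(α, β), fun f => LinearMap.congr_fun hcomp f⟩, rfl⟩
  · rintro ⟨⟨α, β⟩, h⟩
    constructor
    · intro hβ
      have hβ' : β = 0 := hβ
      subst hβ'
      refine ⟨α.codRestrict K fun f => h f, ?_⟩
      exact Subtype.ext (Prod.ext (LinearMap.ext fun f => rfl) rfl)
    · rintro ⟨φ, hφ⟩
      rw [← hφ]
      rfl

section

variable (hmul : ∀ x ∈ I, ∀ y ∈ J, x * y ∈ F)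

/-- The pairing `J × I → R ⧸ F` attached to a pair `(α, β)`, sending `(y, x)` to
`α (x * y) - β x * y`. -/
def linkPairing (α : F →ₗ[R] (R ⧸ F)) (β : I →ₗ[R] (R ⧸ I)) : J →ₗ[R] I →ₗ[R] (R ⧸ F) :=
  LinearMap.mk₂ R (fun y x => α ⟨x * y, hmul x x.2 y y.2⟩ - mulQuotientHom hmul (β x) y)
    (fun y y' x => by
      have : (⟨x * (y + y' : J), hmul x x.2 _ (y + y').2⟩ : F) =
        ⟨x * y, hmul x x.2 y y.2⟩ + ⟨x * y', hmul x x.2 y' y'.2⟩ := Subtype.ext (mul_add _ _ _)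
      rw [this, map_add, map_add]; abel)
    (fun c y x => by
      have : (⟨x * (c • y : J), hmul x x.2 _ (c • y).2⟩ : F) =
        c • ⟨x * y, hmul x x.2 y y.2⟩ := Subtype.ext (mul_left_comm _ _ _)
      rw [this, map_smul, map_smul, smul_sub])
    (fun y x x' => by
      have : (⟨(x + x' : I) * y, hmul _ (x + x').2 y y.2⟩ : F) =
        ⟨x * y, hmul x x.2 y y.2⟩ + ⟨x' * y, hmul x' x'.2 y y.2⟩ := Subtype.ext (add_mul _ _ _)
      rw [this, map_add, map_add, map_add, LinearMap.add_apply]; abel)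
    (fun c y x => by
      have : (⟨(c • x : I) * y, hmul _ (c • x).2 y y.2⟩ : F) =
        c • ⟨x * y, hmul x x.2 y y.2⟩ := Subtype.ext (mul_assoc _ _ _)
      rw [this, map_smul, map_smul, map_smul, LinearMap.smul_apply, smul_sub])

theorem linkPairing_apply (α : F →ₗ[R] (R ⧸ F)) (β : I →ₗ[R] (R ⧸ I)) (y : J) (x : I) :
    linkPairing hmul α β y x =
      α ⟨x * y, hmul x x.2 y y.2⟩ - mulQuotientHom hmul (β x) y := rfl

/-- A flag pair for `F ≤ I` as a pair of a map and a pairing. -/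
def flagPairing (hFI : F ≤ I) :
    flagHom hFI →ₗ[R] (F →ₗ[R] (R ⧸ F)) × (J →ₗ[R] I →ₗ[R] (R ⧸ F)) where
  toFun p := (p.1.1, linkPairing hmul p.1.1 p.1.2)
  map_add' p q := by
    refine Prod.ext rfl (LinearMap.ext fun y => LinearMap.ext fun x => ?_)
    change (p.1.1 + q.1.1) _ - mulQuotientHom hmul (p.1.2 x + q.1.2 x) y =
      (p.1.1 _ - mulQuotientHom hmul (p.1.2 x) y) + (q.1.1 _ - mulQuotientHom hmul (q.1.2 x) y)
    rw [map_add, LinearMap.add_apply, LinearMap.add_apply]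
    abel
  map_smul' c p := by
    refine Prod.ext rfl (LinearMap.ext fun y => LinearMap.ext fun x => ?_)
    change c • p.1.1 _ - mulQuotientHom hmul (c • p.1.2 x) y =
      c • (p.1.1 _ - mulQuotientHom hmul (p.1.2 x) y)
    rw [map_smul, LinearMap.smul_apply, smul_sub]

theorem injective_flagPairing (hFI : F ≤ I) (hI : ∀ r : R, (∀ y ∈ J, r * y ∈ F) → r ∈ I) :
    Function.Injective (flagPairing hmul hFI) := by
  rw [injective_iff_map_eq_zero]
  rintro ⟨⟨α, β⟩, h⟩ h0
  have hα : α = 0 := congrArg Prod.fst h0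
  have hβ : linkPairing hmul α β = 0 := congrArg Prod.snd h0
  have hβ' : β = 0 := by
    ext x
    apply injective_mulQuotientHom hmul hI
    ext y
    have := LinearMap.congr_fun (LinearMap.congr_fun hβ y) x
    rw [linkPairing_apply, hα] at this
    simpa using this
  subst hα hβ'
  rfl

/-- The key step of linkage. For f in F, compatibility makes the pairing at (y, f) equal to α(fy) −
yα(f) = 0. So each y gives a functional on I vanishing on F, hence multiplication by a unique class
β'(y) in R/J, and (α, β') is then a flag pair for J. -/
theorem flagPairing_mem_range (hmul' : ∀ y ∈ J, ∀ x ∈ I, y * x ∈ F) (hFI : F ≤ I) (hFJ : F ≤ J)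
    (hJ : ∀ r : R, (∀ x ∈ I, r * x ∈ F) → r ∈ J)
    (hsurj : ∀ φ : I →ₗ[R] (R ⧸ F), (∀ (f : R) (hf : f ∈ F), φ ⟨f, hFI hf⟩ = 0) →
      φ ∈ LinearMap.range (mulQuotientHom hmul')) (p : flagHom hFI) :
    ∃ q : flagHom hFJ, (q.1.1, (mulQuotientHom hmul') ∘ₗ q.1.2) = flagPairing hmul hFI p := by
  obtain ⟨⟨α, β⟩, h⟩ := p
  have hinj := injective_mulQuotientHom hmul' hJ
  obtain ⟨β', hβ'⟩ := exists_comp_eq_of_range_le hinj (linkPairing hmul α β) (by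
    intro y
    refine hsurj _ fun f hf => ?_
    have h1 : β ⟨f, hFI hf⟩ = Submodule.factor hFI (α ⟨f, hf⟩) := (h ⟨f, hf⟩).symm
    rw [linkPairing_apply, h1, mulQuotientHom_factor, ← map_smul, sub_eq_zero]
    exact congrArg α (Subtype.ext (mul_comm _ _)))
  refine ⟨⟨(α, β'), fun f => hinj (LinearMap.ext fun x => ?_)⟩, Prod.ext rfl hβ'⟩
  have h2 := LinearMap.congr_fun (LinearMap.congr_fun hβ' (Submodule.inclusion hFJ f)) x
  rw [LinearMap.comp_apply] at h2
  change _ = mulQuotientHom hmul' (β' (Submodule.inclusion hFJ f)) x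
  rw [h2, linkPairing_apply, mulQuotientHom_factor]
  have h3 : mulQuotientHom hmul (β x) (Submodule.inclusion hFJ f) = 0 :=
    mulQuotientHom_apply_mem hmul _ f.2 (hFJ f.2)
  rw [h3, sub_zero, ← map_smul]
  rfl

theorem length_flagHom_le (hmul' : ∀ y ∈ J, ∀ x ∈ I, y * x ∈ F) (hFI : F ≤ I) (hFJ : F ≤ J)
    (hI : ∀ r : R, (∀ y ∈ J, r * y ∈ F) → r ∈ I)
    (hJ : ∀ r : R, (∀ x ∈ I, r * x ∈ F) → r ∈ J)
    (hsurj : ∀ φ : I →ₗ[R] (R ⧸ F), (∀ (f : R) (hf : f ∈ F), φ ⟨f, hFI hf⟩ = 0) →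
      φ ∈ LinearMap.range (mulQuotientHom hmul')) :
    Module.length R (flagHom hFI) ≤ Module.length R (flagHom hFJ) := by
  have hmul : ∀ x ∈ I, ∀ y ∈ J, x * y ∈ F := fun x hx y hy => mul_comm y x ▸ hmul' y hy x hx
  let G : flagHom hFJ →ₗ[R] (F →ₗ[R] (R ⧸ F)) × (J →ₗ[R] I →ₗ[R] (R ⧸ F)) :=
    (LinearMap.prodMap LinearMap.id ((mulQuotientHom hmul').compRight R)) ∘ₗ
      (flagHom hFJ).subtype
  have hle : LinearMap.range (flagPairing hmul hFI) ≤ LinearMap.range G := by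
    rintro _ ⟨p, rfl⟩
    exact flagPairing_mem_range hmul hmul' hFI hFJ hJ hsurj p
  exact length_le_of_range_le (P := (F →ₗ[R] (R ⧸ F)) × (J →ₗ[R] I →ₗ[R] (R ⧸ F)))
    (injective_flagPairing hmul hFI hI) hle

end

/-- Evaluation at 1 identifies Hom(R/J, R/F) with (F : J)/F = I/F, and duality preserves length. -/
theorem length_ker_factor_eq [IsLocalRing R] [IsNoetherianRing R] (hs : HasCyclicSocle F)
    (hfin : IsFiniteLength R (R ⧸ F)) (hFI : F ≤ I) (hFJ : F ≤ J)
    (hmul : ∀ x ∈ I, ∀ y ∈ J, x * y ∈ F) (hI : ∀ r : R, (∀ y ∈ J, r * y ∈ F) → r ∈ I) :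
    Module.length R (LinearMap.ker (Submodule.factor hFI)) = Module.length R (R ⧸ J) := by
  let ev : ((R ⧸ J) →ₗ[R] (R ⧸ F)) →ₗ[R] (R ⧸ F) := LinearMap.applyₗ (Ideal.Quotient.mk J 1)
  have hev : ∀ (φ : (R ⧸ J) →ₗ[R] (R ⧸ F)) (y : R), φ (Ideal.Quotient.mk J y) = y • ev φ := by
    intro φ y
    change _ = y • φ _
    rw [← map_smul]
    congr 1
    change _ = Ideal.Quotient.mk J (y * 1)
    rw [mul_one]
  have hinj : Function.Injective ev := by
    rw [injective_iff_map_eq_zero]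
    intro φ hφ
    ext
    change φ (Ideal.Quotient.mk J 1) = 0
    exact hφ
  have hex : Function.Exact ev (Submodule.factor hFI) := by
    intro a
    constructor
    · intro ha
      obtain ⟨a, rfl⟩ := Ideal.Quotient.mk_surjective a
      have ha' : a ∈ I := Ideal.Quotient.eq_zero_iff_mem.mp ha
      refine ⟨J.liftQ (LinearMap.toSpanSingleton R _ (Ideal.Quotient.mk F a)) ?_, ?_⟩
      · intro y hy
        refine Ideal.Quotient.eq_zero_iff_mem.mpr ?_
        change y * a ∈ F
        rw [mul_comm]
        exact hmul a ha' y hy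
      · exact one_smul R (Ideal.Quotient.mk F a)
    · rintro ⟨φ, rfl⟩
      obtain ⟨a, ha⟩ := Ideal.Quotient.mk_surjective (ev φ)
      rw [← ha]
      refine Ideal.Quotient.eq_zero_iff_mem.mpr (hI a fun y hy => ?_)
      have h1 := hev φ y
      rw [Ideal.Quotient.eq_zero_iff_mem.mpr hy, map_zero, ← ha] at h1
      rw [mul_comm]
      exact Ideal.Quotient.eq_zero_iff_mem.mp h1.symm
  have h1 := Module.length_eq_add_of_exact ev (Submodule.factor hFI) hinj
    (Submodule.factor_surjective hFI) hex
  rw [hs.length_linearMap_eq hfin (M := R ⧸ J) fun a ha x => smul_quotient_eq_zero (hFJ ha) x,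
    ← length_ker_factor_add hFI] at h1
  have h2 : Module.length R (R ⧸ I) ≠ ⊤ := ne_top_of_le_ne_top (Module.length_ne_top_iff.mpr hfin)
    (Module.length_le_of_surjective _ (Submodule.factor_surjective hFI))
  exact le_antisymm
    ((ENat.add_le_add_iff_right h2).mp h1.le) ((ENat.add_le_add_iff_right h2).mp h1.ge)

/-- Such a functional lives on I/F. The dual of I/F has length λ(I/F) = λ(R/J), and R/J embeds in it
by multiplication because (F : I) = J; equal finite lengths make the embedding onto. -/
theorem mem_range_mulQuotientHom [IsLocalRing R] [IsNoetherianRing R] (hs : HasCyclicSocle F)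
    (hfin : IsFiniteLength R (R ⧸ F)) (hFI : F ≤ I) (hFJ : F ≤ J)
    (hmul : ∀ x ∈ I, ∀ y ∈ J, x * y ∈ F) (hI : ∀ r : R, (∀ y ∈ J, r * y ∈ F) → r ∈ I)
    (hmul' : ∀ y ∈ J, ∀ x ∈ I, y * x ∈ F) (hJ : ∀ r : R, (∀ x ∈ I, r * x ∈ F) → r ∈ J)
    (φ : I →ₗ[R] (R ⧸ F)) (hφ : ∀ (f : R) (hf : f ∈ F), φ ⟨f, hFI hf⟩ = 0) :
    φ ∈ LinearMap.range (mulQuotientHom hmul') := by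
  let K := LinearMap.ker (Submodule.factor hFI)
  let q : I →ₗ[R] K := LinearMap.codRestrict K (F.mkQ ∘ₗ I.subtype) fun x =>
    Ideal.Quotient.eq_zero_iff_mem.mpr x.2
  have hq : Function.Surjective q := by
    rintro ⟨a, ha⟩
    obtain ⟨a, rfl⟩ := Ideal.Quotient.mk_surjective a
    exact ⟨⟨a, Ideal.Quotient.eq_zero_iff_mem.mp ha⟩, rfl⟩
  obtain ⟨ψ, hψ⟩ := exists_comp_eq_of_ker_le hq φ (by
    intro x hx
    have hx' : (x : R) ∈ F := Ideal.Quotient.eq_zero_iff_mem.mp (congrArg Subtype.val hx)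
    exact hφ x hx')
  let P : (R ⧸ J) →ₗ[R] (K →ₗ[R] (R ⧸ F)) :=
    J.liftQ (LinearMap.toSpanSingleton R _ K.subtype) fun y hy => by
      refine LinearMap.ext fun a => ?_
      obtain ⟨x, rfl⟩ := hq a
      exact Ideal.Quotient.eq_zero_iff_mem.mpr (hmul' y hy x x.2)
  have hP : Function.Injective P := by
    rw [injective_iff_map_eq_zero]
    intro a ha
    obtain ⟨a, rfl⟩ := Ideal.Quotient.mk_surjective a
    refine Ideal.Quotient.eq_zero_iff_mem.mpr (hJ a fun x hx => ?_)
    exact Ideal.Quotient.eq_zero_iff_mem.mp (LinearMap.congr_fun ha (q ⟨x, hx⟩))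
  have hlen : Module.length R (K →ₗ[R] (R ⧸ F)) = Module.length R (R ⧸ J) := by
    rw [hs.length_linearMap_eq hfin fun a ha x => Subtype.ext (smul_quotient_eq_zero ha _)]
    exact length_ker_factor_eq hs hfin hFI hFJ hmul hI
  have hfinJ : Module.length R (R ⧸ J) ≠ ⊤ :=
    ne_top_of_le_ne_top (Module.length_ne_top_iff.mpr hfin)
      (Module.length_le_of_surjective _ (Submodule.factor_surjective hFJ))
  obtain ⟨r, hr⟩ := surjective_of_injective_of_length_le hP hlen.le (hlen ▸ hfinJ) ψ
  refine ⟨r, ?_⟩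
  obtain ⟨r, rfl⟩ := Ideal.Quotient.mk_surjective r
  rw [← hψ, ← hr]
  rfl

theorem length_hom_add_le_of_link [IsLocalRing R] [IsNoetherianRing R] {xs : List R}
    (reg : IsWeaklyRegular R xs) (hs : HasCyclicSocle (Ideal.ofList xs))
    (hfin : IsFiniteLength R (R ⧸ Ideal.ofList xs))
    (hFI : Ideal.ofList xs ≤ I) (hFJ : Ideal.ofList xs ≤ J)
    (hJ : J = (Ideal.ofList xs).colon (I : Set R)) (hI : I = (Ideal.ofList xs).colon (J : Set R)) :
    xs.length * Module.length R (R ⧸ J) + Module.length R (I →ₗ[R] (R ⧸ I)) ≤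
      xs.length * Module.length R (R ⧸ I) + Module.length R (J →ₗ[R] (R ⧸ J)) := by
  have hmemI : ∀ r : R, r ∈ I ↔ ∀ y ∈ J, r * y ∈ Ideal.ofList xs := by
    intro r
    conv_lhs => rw [hI]
    exact Submodule.mem_colon
  have hmemJ : ∀ r : R, r ∈ J ↔ ∀ y ∈ I, r * y ∈ Ideal.ofList xs := by
    intro r
    conv_lhs => rw [hJ]
    exact Submodule.mem_colon
  have hmul : ∀ x ∈ I, ∀ y ∈ J, x * y ∈ Ideal.ofList xs := fun x hx => (hmemI x).mp hx
  have hmul' : ∀ y ∈ J, ∀ x ∈ I, y * x ∈ Ideal.ofList xs := fun x hx => (hmemJ x).mp hx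
  have hI' := fun r => (hmemI r).mpr
  have hJ' := fun r => (hmemJ r).mpr
  rw [← length_ker_factor_eq hs hfin hFI hFJ hmul hI',
    ← length_ker_factor_eq hs hfin hFJ hFI hmul' hJ', ← length_flagHom reg hFI,
    ← length_flagHom reg hFJ]
  exact length_flagHom_le hmul' hFI hFJ hI' hJ'
    (mem_range_mulQuotientHom hs hfin hFI hFJ hmul hI' hmul' hJ')

end Linkage

/-! ### Licci ideals. -/

section Licci

open IsLocalRing

variable {R : Type u} [CommRing R]

theorem exists_socle_of_isFiniteLength [IsLocalRing R] {I : Ideal R} (hI : I ≠ ⊤)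
    (hfin : IsFiniteLength R (R ⧸ I)) : ∃ b ∉ I, ∀ r ∈ maximalIdeal R, r * b ∈ I := by
  have : Nontrivial (R ⧸ I) := Ideal.Quotient.nontrivial_iff.mpr hI
  have := (isFiniteLength_iff_isNoetherian_isArtinian.mp hfin).2
  obtain ⟨S, hS, -⟩ := (eq_bot_or_exists_atom_le (⊤ : Submodule R (R ⧸ I))).resolve_left top_ne_bot
  have hsimple : IsSimpleModule R S := isSimpleModule_iff_isAtom.mpr hS
  obtain ⟨e⟩ := nonempty_equiv_residue_of_isSimpleModule (R := R) S
  obtain ⟨⟨s, hsS⟩, hs0⟩ := @exists_ne S (IsSimpleModule.nontrivial R S) 0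
  obtain ⟨b, rfl⟩ := Ideal.Quotient.mk_surjective s
  refine ⟨b, fun hb => hs0 (Subtype.ext (Ideal.Quotient.eq_zero_iff_mem.mpr hb)), fun r hr => ?_⟩
  have h1 : r • (⟨_, hsS⟩ : S) = 0 := by
    apply e.injective
    rw [map_smul, map_zero]
    exact smul_quotient_eq_zero hr _
  exact Ideal.Quotient.eq_zero_iff_mem.mp (congrArg Subtype.val h1)

variable [IsGorensteinLocalRing R]

/-- A shorter sequence would leave R/(xs) with zero socle. But if b is a socle element modulo I =
(xs) : J, each bj with j in J is a socle element modulo (xs), hence zero there, which forces b into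
I. -/
theorem IsGorensteinLocalRing.ringKrullDim_eq_length_of_link {I J : Ideal R} {xs : List R}
    (reg : IsRegular R xs) (hI : I ≠ ⊤) (hfin : IsFiniteLength R (R ⧸ I))
    (hIJ : I = (Ideal.ofList xs).colon (J : Set R)) : ringKrullDim R = xs.length := by
  obtain ⟨ys, regy, hy, -⟩ := IsGorensteinLocalRing.exists_isRegular_of_isFiniteLength hI hfin
  have hle := length_le_ringKrullDim_of_isRegular reg
  by_contra hne
  have hlt : xs.length < ys.length := by
    rw [hy] at hle hne
    have h1 : xs.length ≤ ys.length := by exact_mod_cast hle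
    have h2 : ys.length ≠ xs.length := by exact_mod_cast hne
    omega
  have hsub := subsingleton_ext_residue regy hlt
  obtain ⟨e⟩ := exists_ext_length_equiv_linearMap_quotient (R ⧸ maximalIdeal R) xs reg
    (by rw [Ideal.annihilator_quotient]; exact mem_maximalIdeal_of_isRegular reg)
  have hsub' : Subsingleton ((R ⧸ maximalIdeal R) →ₗ[R] (R ⧸ Ideal.ofList xs)) :=
    e.symm.toEquiv.subsingleton
  obtain ⟨b, hbI, hb⟩ := exists_socle_of_isFiniteLength hI hfin
  apply hbI
  rw [hIJ]
  refine Submodule.mem_colon.mpr fun j hj => ?_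
  have hbj : ∀ r ∈ maximalIdeal R, r * (b * j) ∈ Ideal.ofList xs := by
    intro r hr
    have h1 := hb r hr
    rw [hIJ] at h1
    rw [← mul_assoc]
    exact Submodule.mem_colon.mp h1 j hj
  have h2 := LinearMap.congr_fun (hsub'.elim (socleMap (b * j) hbj) 0) (Ideal.Quotient.mk _ 1)
  change (1 : R) • Ideal.Quotient.mk (Ideal.ofList xs) (b * j) = 0 at h2
  rw [one_smul] at h2
  exact Ideal.Quotient.eq_zero_iff_mem.mp h2

/-- Induction from the complete intersection end of the chain, where equality holds. Each link must
again be by a sequence of length d, so finite length passes to the next ideal and the comparison of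
flag lengths applies. -/
theorem IsLicci.length_le {d : ℕ} (hd : ringKrullDim R = d) {I : Ideal R} (h : IsLicci I)
    (hfin : IsFiniteLength R (R ⧸ I)) :
    d * Module.length R (R ⧸ I) ≤ Module.length R (I →ₗ[R] (R ⧸ I)) := by
  obtain ⟨C, hchain, xs, reg, rfl⟩ := h
  induction hchain using Relation.ReflTransGen.head_induction_on with
  | refl =>
    have hdim := ringKrullDim_add_length_eq_ringKrullDim_of_isRegular xs reg
    have hne : Ideal.ofList xs ≠ ⊤ := ne_top_of_le_ne_top (maximalIdeal.isMaximal R).ne_top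
      (mem_maximalIdeal_of_isRegular reg)
    rw [ringKrullDim_quotient_eq_zero hne hfin, zero_add, hd] at hdim
    have hlen : xs.length = d := by exact_mod_cast hdim
    rw [length_linearMap_ofList reg.toIsWeaklyRegular _ fun a ha x => smul_quotient_eq_zero ha x,
      hlen]
  | @head I J hlink _ ih =>
    obtain ⟨hI, hJ, ys, regy, hle, hJI, hIJ⟩ := hlink
    have hdim := IsGorensteinLocalRing.ringKrullDim_eq_length_of_link regy hI hfin hIJ
    have hlen : ys.length = d := by
      rw [hd] at hdim
      exact_mod_cast hdim.symm
    have hfiny := isFiniteLength_quotient_ofList regy hdim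
    have hfinJ : IsFiniteLength R (R ⧸ J) := by
      rw [← Module.length_ne_top_iff] at hfiny ⊢
      exact ne_top_of_le_ne_top hfiny (Module.length_le_of_surjective _
        (Submodule.factor_surjective (hle.trans inf_le_right)))
    have hJle := ih hfinJ
    have key := length_hom_add_le_of_link regy.toIsWeaklyRegular
      (IsGorensteinLocalRing.hasCyclicSocle regy hdim) hfiny (hle.trans inf_le_right)
      (hle.trans inf_le_left) hIJ hJI
    rw [hlen] at key
    have hne : (d : ℕ∞) * Module.length R (R ⧸ J) ≠ ⊤ :=
      natCast_mul_ne_top d (Module.length_ne_top_iff.mpr hfinJ)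
    rw [add_comm ((d : ℕ∞) * Module.length R (R ⧸ J))] at key
    exact (ENat.add_le_add_iff_right hne).mp ((add_le_add_right hJle _).trans key)

end Licci

/-! ### The inequality restated as d·λ(R/I) ≤ λ(Hom(I, R/I)). -/

section Reduction

open IsLocalRing

variable {R : Type u} [CommRing R] [IsLocalRing R]

theorem eq_maximalIdeal_of_isFiniteLength {I : Ideal R} (hfin : IsFiniteLength R (R ⧸ I))
    {p : Ideal R} [p.IsPrime] (hp : I ≤ p) : p = maximalIdeal R := by
  have hdim := krullDimLE_zero_quotient_of_isFiniteLength hfin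
  rw [Ring.krullDimLE_zero_iff] at hdim
  have h1 : (p.map (Ideal.Quotient.mk I)).IsPrime :=
    Ideal.map_isPrime_of_surjective Ideal.Quotient.mk_surjective (by rwa [Ideal.mk_ker])
  have h2 : ((p.map (Ideal.Quotient.mk I)).comap (Ideal.Quotient.mk I)).IsMaximal :=
    Ideal.comap_isMaximal_of_surjective _ Ideal.Quotient.mk_surjective (K := p.map _)
      (H := hdim _ h1)
  rw [Ideal.comap_map_of_surjective _ Ideal.Quotient.mk_surjective, ← RingHom.ker_eq_comap_bot,
    Ideal.mk_ker, sup_eq_left.mpr hp] at h2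
  exact eq_maximalIdeal h2

theorem height_eq_ringKrullDim_of_isFiniteLength {I : Ideal R} (hI : I ≠ ⊤)
    (hfin : IsFiniteLength R (R ⧸ I)) : (I.height : WithBot ℕ∞) = ringKrullDim R := by
  refine le_antisymm (Ideal.height_le_ringKrullDim_of_ne_top hI) ?_
  rw [← maximalIdeal_height_eq_ringKrullDim, WithBot.coe_le_coe,
    Ideal.height_eq_inf_minimalPrimes I]
  refine le_iInf₂ fun p hp => ?_
  have : p.IsPrime := hp.1.1
  have h := eq_maximalIdeal_of_isFiniteLength hfin hp.1.2
  rw [h]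

theorem conormalInequality_iff [IsNoetherianRing R] {I : Ideal R} (hI : I ≠ ⊤)
    (hfin : IsFiniteLength R (R ⧸ I)) {ys : List R}
    (reg : IsRegular R ys) (hle : Ideal.ofList ys ≤ I) (hdim : ringKrullDim R = ys.length)
    (hs : HasCyclicSocle (Ideal.ofList ys)) :
    ConormalInequality I ↔
      ys.length * Module.length R (R ⧸ I) ≤ Module.length R (I →ₗ[R] (R ⧸ I)) := by
  have hh : I.height.toNat = ys.length := by
    have h1 := height_eq_ringKrullDim_of_isFiniteLength hI hfin
    rw [hdim] at h1
    have h2 : I.height = (ys.length : ℕ∞) := by exact_mod_cast h1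
    rw [h2, ENat.toNat_natCast]
  rw [ConormalInequality, length_twistedConormal reg hle hh hs
    (isFiniteLength_quotient_ofList reg hdim), hdim, ← WithBot.coe_natCast, ← WithBot.coe_mul,
    WithBot.coe_le_coe]

omit [IsLocalRing R] in
theorem conormalInequality_top : ConormalInequality (⊤ : Ideal R) := by
  have : Subsingleton (R ⧸ (⊤ : Ideal R)) := Ideal.Quotient.subsingleton_iff.mpr rfl
  rw [ConormalInequality, Module.length_eq_zero, WithBot.coe_zero, mul_zero]
  exact WithBot.coe_nonneg.mpr bot_le

end Reduction

/-! ### Change of rings along a surjection. -/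

section Surjection

variable {R : Type u} {Q : Type v} [CommRing R] [CommRing Q] [Algebra Q R]
  (hπ : Function.Surjective (algebraMap Q R))

include hπ

theorem exists_quotient_comap_equiv (I : Ideal R) :
    Nonempty ((Q ⧸ I.comap (algebraMap Q R)) ≃ₗ[Q] (R ⧸ I)) := by
  let f : Q →ₗ[Q] (R ⧸ I) := I.mkQ.restrictScalars Q ∘ₗ Algebra.linearMap Q R
  have hf : Function.Surjective f := (Submodule.mkQ_surjective I).comp hπ
  have hker : LinearMap.ker f = I.comap (algebraMap Q R) := by
    ext x
    exact Ideal.Quotient.eq_zero_iff_mem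
  exact ⟨(Submodule.quotEquivOfEq _ _ hker.symm).trans (f.quotKerEquivOfSurjective hf)⟩

theorem length_quotient_comap (I : Ideal R) :
    Module.length Q (Q ⧸ I.comap (algebraMap Q R)) = Module.length R (R ⧸ I) := by
  obtain ⟨e⟩ := exists_quotient_comap_equiv hπ I
  rw [e.length_eq, Module.length_eq_of_surjective hπ]

/-- A map on J killing the kernel of J → I factors through I, and Q-linear is R-linear as Q → R is
onto. Allowing a submodule U serves two uses: for a ring deformation only some maps kill this
kernel, for a deformation of the pair all do. -/
theorem length_submodule_hom_le {J : Ideal Q} {I : Ideal R} (hJ : J.map (algebraMap Q R) = I)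
    {X : Type w} [AddCommGroup X] [Module Q X] (e : X ≃ₗ[Q] (R ⧸ I))
    (U : Submodule Q (J →ₗ[Q] X))
    (hU : ∀ φ ∈ U, ∀ j : J, algebraMap Q R j = 0 → φ j = 0) :
    Module.length Q U ≤ Module.length R (I →ₗ[R] (R ⧸ I)) := by
  let τ : J →ₗ[Q] I :=
    { toFun := fun j => ⟨algebraMap Q R j, hJ ▸ Ideal.mem_map_of_mem _ j.2⟩
      map_add' := fun x y => Subtype.ext (map_add _ _ _)
      map_smul' := fun c x => Subtype.ext ((map_mul _ _ _).trans (Algebra.smul_def _ _).symm) }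
  have hτ : Function.Surjective τ := by
    rintro ⟨x, hx⟩
    rw [← hJ, Ideal.mem_map_iff_of_surjective _ hπ] at hx
    obtain ⟨j, hj, rfl⟩ := hx
    exact ⟨⟨j, hj⟩, rfl⟩
  let Ψ : (I →ₗ[R] (R ⧸ I)) →ₗ[Q] (J →ₗ[Q] X) :=
    { toFun := fun ψ => e.symm.toLinearMap ∘ₗ ψ.restrictScalars Q ∘ₗ τ
      map_add' := fun x y => LinearMap.ext fun j => map_add e.symm _ _
      map_smul' := fun c x => LinearMap.ext fun j => map_smul e.symm c _ }
  have hle : LinearMap.range U.subtype ≤ LinearMap.range Ψ := by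
    rintro _ ⟨⟨φ, hφ⟩, rfl⟩
    obtain ⟨k, hk⟩ := exists_comp_eq_of_ker_le hτ (e.toLinearMap ∘ₗ φ) (by
      intro j hj
      have h0 := hU φ hφ j (congrArg Subtype.val hj)
      rw [LinearMap.mem_ker, LinearMap.comp_apply, h0, map_zero])
    refine ⟨k.extendScalarsOfSurjective hπ, LinearMap.ext fun j => ?_⟩
    change e.symm (k (τ j)) = φ j
    rw [LinearEquiv.symm_apply_eq]
    exact LinearMap.congr_fun hk j
  rw [← Module.length_eq_of_surjective hπ (M := I →ₗ[R] (R ⧸ I))]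
  exact length_le_of_range_le U.injective_subtype hle

end Surjection

/-! ### Case 1: deforming the ring. -/

section Deformation

open IsLocalRing

variable {R : Type u} {Q : Type v} [CommRing R] [CommRing Q]

theorem exists_list_map_eq (π : Q →+* R) {J : Ideal Q} {ys : List R}
    (h : ∀ y ∈ ys, ∃ z ∈ J, π z = y) : ∃ zs : List Q, (∀ z ∈ zs, z ∈ J) ∧ zs.map π = ys := by
  induction ys with
  | nil => exact ⟨[], by simp, rfl⟩
  | cons y ys ih =>
    obtain ⟨z, hz, rfl⟩ := h y (by simp)
    obtain ⟨zs, hzs, rfl⟩ := ih fun y hy => h y (by simp [hy])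
    exact ⟨z :: zs, by simpa [hz] using hzs, rfl⟩

theorem ofList_append_eq_comap {π : Q →+* R} (hπ : Function.Surjective π) {xs zs : List Q}
    (hker : RingHom.ker π = Ideal.ofList xs) :
    Ideal.ofList (xs ++ zs) = (Ideal.ofList (zs.map π)).comap π := by
  rw [← Ideal.map_ofList, Ideal.comap_map_of_surjective _ hπ, ← RingHom.ker_eq_comap_bot, hker,
    Ideal.ofList_append, sup_comm]

theorem isRegular_append_of_surjective {π : Q →+* R} (hπ : Function.Surjective π) {xs zs : List Q}
    (regx : IsRegular Q xs) (hker : RingHom.ker π = Ideal.ofList xs)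
    (regz : IsRegular R (zs.map π)) : IsRegular Q (xs ++ zs) := by
  let _ : Algebra Q R := π.toAlgebra
  refine ⟨(isWeaklyRegular_append_iff Q xs zs).mpr ⟨regx.toIsWeaklyRegular, ?_⟩, ?_⟩
  · let f : Q →ₗ[Q] R := Algebra.linearMap Q R
    have hf : LinearMap.ker f = Ideal.ofList xs • (⊤ : Submodule Q Q) := by
      rw [smul_eq_mul, Ideal.mul_top, ← hker]
      rfl
    let e : (Q ⧸ (Ideal.ofList xs • (⊤ : Submodule Q Q))) ≃ₗ[Q] R :=
      (Submodule.quotEquivOfEq _ _ hf.symm).trans (f.quotKerEquivOfSurjective hπ)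
    rw [e.isWeaklyRegular_congr]
    exact (isWeaklyRegular_map_algebraMap_iff R R zs).mp regz.toIsWeaklyRegular
  · intro h
    rw [smul_eq_mul, Ideal.mul_top, ofList_append_eq_comap hπ hker, eq_comm,
      Ideal.comap_eq_top_iff] at h
    apply regz.2
    rw [h, smul_eq_mul, Ideal.mul_top]

theorem ringKrullDim_eq_add_length [IsLocalRing Q] [IsNoetherianRing Q] {π : Q →+* R}
    (hπ : Function.Surjective π) {xs : List Q}
    (regx : IsRegular Q xs) (hker : RingHom.ker π = Ideal.ofList xs) :
    ringKrullDim Q = ringKrullDim R + xs.length := by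
  rw [← ringKrullDim_add_length_eq_ringKrullDim_of_isRegular xs regx,
    ringKrullDim_eq_of_ringEquiv ((Ideal.quotEquivOfEq hker.symm).trans
      (RingHom.quotientKerEquivOfSurjective hπ))]

/-- Lets the restated inequality be used in Q through the lifted regular sequence, without proving
that Q is Gorenstein. -/
theorem HasCyclicSocle.comap [IsLocalRing Q] [IsLocalRing R] {π : Q →+* R}
    (hπ : Function.Surjective π) {𝔞 : Ideal R} (h : HasCyclicSocle 𝔞) :
    HasCyclicSocle (𝔞.comap π) := by
  have := IsLocalHom.of_surjective π hπ
  have hmem : ∀ r, r ∈ maximalIdeal Q ↔ π r ∈ maximalIdeal R := fun r => by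
    rw [mem_maximalIdeal, mem_maximalIdeal, mem_nonunits_iff, mem_nonunits_iff, isUnit_map_iff]
  obtain ⟨a, ha, hgen⟩ := h
  obtain ⟨a, rfl⟩ := hπ a
  refine ⟨a, fun r hr => ?_, fun b hb => ?_⟩
  · rw [Ideal.mem_comap, map_mul]
    exact ha _ ((hmem r).mp hr)
  · obtain ⟨c, hc⟩ := hgen (π b) fun r hr => by
      obtain ⟨r, rfl⟩ := hπ r
      have := hb r ((hmem r).mpr hr)
      rwa [Ideal.mem_comap, map_mul] at this
    obtain ⟨c, rfl⟩ := hπ c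
    refine ⟨c, ?_⟩
    rwa [Ideal.mem_comap, map_sub, map_mul]

/-- Restrict to ker π = (xs): a map there is determined by its values on the |xs| generators, and
the maps restricting to zero descend to I. -/
theorem length_hom_comap_le {π : Q →+* R} (hπ : Function.Surjective π) {xs : List Q}
    (hker : RingHom.ker π = Ideal.ofList xs) (I : Ideal R) :
    Module.length Q (I.comap π →ₗ[Q] (Q ⧸ I.comap π)) ≤
      Module.length R (I →ₗ[R] (R ⧸ I)) + xs.length * Module.length R (R ⧸ I) := by
  let _ : Algebra Q R := π.toAlgebra
  have hKJ : Ideal.ofList xs ≤ I.comap π := by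
    rw [← hker, RingHom.ker_eq_comap_bot]
    exact Ideal.comap_mono bot_le
  let res : (I.comap π →ₗ[Q] (Q ⧸ I.comap π)) →ₗ[Q] (Ideal.ofList xs →ₗ[Q] (Q ⧸ I.comap π)) :=
    LinearMap.lcomp Q _ (Submodule.inclusion hKJ)
  refine (length_le_add_of_exact (R := Q) (M := I.comap π →ₗ[Q] (Q ⧸ I.comap π))
    (P := Ideal.ofList xs →ₗ[Q] (Q ⧸ I.comap π)) (f := (LinearMap.ker res).subtype) (g := res)
    (N := LinearMap.ker res) res.exact_subtype_ker_map).trans (add_le_add ?_ ?_)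
  · obtain ⟨e⟩ := exists_quotient_comap_equiv (Q := Q) hπ I
    refine length_submodule_hom_le hπ (Ideal.map_comap_of_surjective _ hπ I) e _ ?_
    intro φ hφ j hj
    have hj' : (j : Q) ∈ Ideal.ofList xs := by
      rw [← hker]
      exact hj
    exact LinearMap.congr_fun hφ ⟨j, hj'⟩
  · refine (Module.length_le_of_injective _ (injective_evalOfList xs _)).trans ?_
    rw [Module.length_pi_of_fintype, ← length_quotient_comap (Q := Q) hπ I]
    simp
    rfl

theorem ConormalInequality.of_deformsAlong [IsGorensteinLocalRing R] {I : Ideal R}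
    (hfin : IsFiniteLength R (R ⧸ I)) [IsLocalRing Q] [IsNoetherianRing Q] {π : Q →+* R}
    (hdef : DeformsAlong π (⊥ : Ideal R) (⊥ : Ideal Q)) (hQ : ConormalInequality (I.comap π)) :
    ConormalInequality I := by
  rcases eq_or_ne I ⊤ with rfl | hI
  · exact conormalInequality_top
  obtain ⟨hπ, xs, regx, -, hker, -⟩ := hdef
  obtain ⟨ys, regy, hdim, hle⟩ :=
    IsGorensteinLocalRing.exists_isRegular_of_isFiniteLength hI hfin
  have hs := IsGorensteinLocalRing.hasCyclicSocle regy hdim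
  rw [conormalInequality_iff hI hfin regy hle hdim hs]
  obtain ⟨zs, -, rfl⟩ := exists_list_map_eq π (J := ⊤) (ys := ys)
    fun y _ => (hπ y).imp fun z hz => ⟨trivial, hz⟩
  have hlen : (zs.map π).length = zs.length := List.length_map _
  have hJ := ofList_append_eq_comap hπ (zs := zs) hker
  have hlenJ : Module.length Q (Q ⧸ I.comap π) = Module.length R (R ⧸ I) :=
    let _ : Algebra Q R := π.toAlgebra
    length_quotient_comap hπ I
  have hfinJ : IsFiniteLength Q (Q ⧸ I.comap π) := by
    rw [← Module.length_ne_top_iff, hlenJ]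
    exact Module.length_ne_top_iff.mpr hfin
  have key := (conormalInequality_iff (by rwa [Ne, Ideal.comap_eq_top_iff]) hfinJ
    (isRegular_append_of_surjective hπ regx hker regy)
    (by rw [hJ]; exact Ideal.comap_mono hle)
    (by rw [ringKrullDim_eq_add_length hπ regx hker, hdim, hlen, List.length_append, add_comm]
        push_cast
        rfl)
    (by rw [hJ]; exact hs.comap hπ)).mp hQ
  have hle2 := key.trans (length_hom_comap_le hπ hker I)
  rw [hlenJ, List.length_append, Nat.cast_add, add_mul, add_comm] at hle2
  rw [hlen]
  exact (ENat.add_le_add_iff_right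
    (natCast_mul_ne_top _ (Module.length_ne_top_iff.mpr hfin))).mp hle2

end Deformation

/-! ### Passing from a sequence to the sequence of k-th powers. -/

section Powers

variable {R : Type u} [CommRing R] {N : Type v} [AddCommGroup N] [Module R N]

open scoped Pointwise

/-- The map `N / xʲN → N / xʲ⁺¹N` induced by multiplication by `x`. -/
def quotPowMul (x : R) (j : ℕ) (N : Type v) [AddCommGroup N] [Module R N] :
    QuotSMulTop (x ^ j) N →ₗ[R] QuotSMulTop (x ^ (j + 1)) N :=
  Submodule.mapQ _ _ (LinearMap.lsmul R N x) (by
    rintro _ ⟨n, -, rfl⟩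
    refine ⟨n, trivial, ?_⟩
    change x ^ (j + 1) • n = x • x ^ j • n
    rw [smul_smul, pow_succ'])

/-- The projection `N / xʲ⁺¹N → N / xN`. -/
def quotPowProj (x : R) (j : ℕ) (N : Type v) [AddCommGroup N] [Module R N] :
    QuotSMulTop (x ^ (j + 1)) N →ₗ[R] QuotSMulTop x N :=
  Submodule.factor (by
    rintro _ ⟨n, -, rfl⟩
    refine ⟨x ^ j • n, trivial, ?_⟩
    change x • x ^ j • n = x ^ (j + 1) • n
    rw [smul_smul, pow_succ'])

theorem surjective_quotPowProj (x : R) (j : ℕ) : Function.Surjective (quotPowProj x j N) :=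
  Submodule.factor_surjective (by
    rintro _ ⟨n, -, rfl⟩
    refine ⟨x ^ j • n, trivial, ?_⟩
    change x • x ^ j • n = x ^ (j + 1) • n
    rw [smul_smul, pow_succ'])

theorem exact_quotPow (x : R) (j : ℕ) :
    Function.Exact (quotPowMul x j N) (quotPowProj x j N) := by
  intro y
  obtain ⟨n, rfl⟩ := Submodule.mkQ_surjective _ y
  constructor
  · intro h
    obtain ⟨m, -, hm⟩ := (Submodule.Quotient.mk_eq_zero (x • (⊤ : Submodule R N))).mp h
    exact ⟨Submodule.Quotient.mk m, congrArg Submodule.Quotient.mk hm⟩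
  · rintro ⟨z, hz⟩
    obtain ⟨m, rfl⟩ := Submodule.mkQ_surjective _ z
    rw [← hz]
    exact (Submodule.Quotient.mk_eq_zero (x • (⊤ : Submodule R N))).mpr ⟨m, trivial, rfl⟩

theorem injective_quotPowMul {x : R} (hx : IsSMulRegular N x) (j : ℕ) :
    Function.Injective (quotPowMul x j N) := by
  rw [injective_iff_map_eq_zero]
  intro y hy
  obtain ⟨n, rfl⟩ := Submodule.mkQ_surjective _ y
  obtain ⟨m, -, hm⟩ := (Submodule.Quotient.mk_eq_zero (x ^ (j + 1) • (⊤ : Submodule R N))).mp hy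
  refine (Submodule.Quotient.mk_eq_zero (x ^ j • (⊤ : Submodule R N))).mpr ⟨m, trivial, hx ?_⟩
  change x • x ^ j • m = x • n
  rw [smul_smul, ← pow_succ']
  exact hm

theorem subsingleton_quotSMulTop_pow_zero (x : R) : Subsingleton (QuotSMulTop (x ^ 0) N) := by
  rw [Submodule.Quotient.subsingleton_iff, pow_zero, one_smul]

theorem length_quotSMulTop_pow_le (x : R) (k : ℕ) :
    Module.length R (QuotSMulTop (x ^ k) N) ≤ k * Module.length R (QuotSMulTop x N) := by
  induction k with
  | zero =>
    have := subsingleton_quotSMulTop_pow_zero (N := N) x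
    rw [Module.length_eq_zero]
    exact bot_le
  | succ k ih =>
    refine (length_le_add_of_exact (exact_quotPow x k)).trans ?_
    rw [Nat.cast_add, add_mul, Nat.cast_one, one_mul]
    exact add_le_add_left ih _

/-- Without regularity the filtration by powers is only right exact; this upper bound is enough for
growth estimates. -/
theorem length_quotient_ofList_pow_le (xs : List R) (k : ℕ) (N : Type v) [AddCommGroup N]
    [Module R N] :
    Module.length R (N ⧸ (Ideal.ofList (xs.map (· ^ k)) • (⊤ : Submodule R N))) ≤
      (k ^ xs.length : ℕ) * Module.length R (N ⧸ (Ideal.ofList xs • (⊤ : Submodule R N))) := by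
  induction xs generalizing N with
  | nil =>
    rw [List.map_nil, List.length_nil, pow_zero, Nat.cast_one, one_mul]
  | cons x xs ih =>
    rw [List.map_cons,
      (Submodule.quotOfListConsSMulTopEquivQuotSMulTopInner N (x ^ k) _).length_eq,
      (Submodule.quotOfListConsSMulTopEquivQuotSMulTopOuter N x xs).length_eq]
    refine (ih _).trans ?_
    rw [← (Submodule.quotOfListConsSMulTopEquivQuotSMulTopInner N (x ^ k) xs).length_eq,
      (Submodule.quotOfListConsSMulTopEquivQuotSMulTopOuter N (x ^ k) xs).length_eq,
      List.length_cons, pow_succ, Nat.cast_mul, mul_assoc]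
    gcongr
    exact length_quotSMulTop_pow_le x k

/-- `M` has length `c * L`, and `Hom(J, M)` has length at most `c * H`. -/
structure HasLengthBounds (R : Type u) [CommRing R] (J : Type w) [AddCommGroup J] [Module R J]
    (L H : ℕ∞) (c : ℕ) (M : Type v) [AddCommGroup M] [Module R M] : Prop where
  length_eq : Module.length R M = c * L
  length_hom_le : Module.length R (J →ₗ[R] M) ≤ c * H

namespace HasLengthBounds

variable {J : Type w} [AddCommGroup J] [Module R J] {L H : ℕ∞}
  {A B C : Type v} [AddCommGroup A] [Module R A] [AddCommGroup B] [Module R B]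
  [AddCommGroup C] [Module R C]

theorem of_subsingleton [Subsingleton A] : HasLengthBounds R J L H 0 A := by
  have : Subsingleton (J →ₗ[R] A) := ⟨fun f g => LinearMap.ext fun x => Subsingleton.elim _ _⟩
  constructor
  · rw [Module.length_eq_zero, Nat.cast_zero, zero_mul]
  · rw [Module.length_eq_zero, Nat.cast_zero, zero_mul]

theorem congr (e : A ≃ₗ[R] B) {c : ℕ} (h : HasLengthBounds R J L H c A) :
    HasLengthBounds R J L H c B :=
  ⟨e.length_eq.symm.trans h.1, (LinearEquiv.congrRight (M := J) e).length_eq.symm.le.trans h.2⟩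

theorem of_exact {f : A →ₗ[R] B} {g : B →ₗ[R] C} (hf : Function.Injective f)
    (hg : Function.Surjective g) (hfg : Function.Exact f g) {a c : ℕ}
    (hA : HasLengthBounds R J L H a A) (hC : HasLengthBounds R J L H c C) :
    HasLengthBounds R J L H (a + c) B := by
  constructor
  · rw [Module.length_eq_add_of_exact f g hf hg hfg, hA.1, hC.1, Nat.cast_add, add_mul]
  · have hex : Function.Exact (LinearMap.compRight R f (M := J))
        (LinearMap.compRight R g (M := J)) := by
      intro φ
      constructor
      · intro hφ
        exact exists_comp_eq_of_range_le hf φ fun j => (hfg (φ j)).mp (LinearMap.congr_fun hφ j)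
      · rintro ⟨ψ, rfl⟩
        exact LinearMap.ext fun j => hfg.apply_apply_eq_zero (ψ j)
    refine (length_le_add_of_exact hex).trans ?_
    rw [Nat.cast_add, add_mul]
    exact add_le_add hA.2 hC.2

theorem quotSMulTop_pow {x : R} (hx : IsSMulRegular A x) {c : ℕ}
    (h : HasLengthBounds R J L H c (QuotSMulTop x A)) (k : ℕ) :
    HasLengthBounds R J L H (k * c) (QuotSMulTop (x ^ k) A) := by
  induction k with
  | zero =>
    have := subsingleton_quotSMulTop_pow_zero (N := A) x
    rw [zero_mul]
    exact of_subsingleton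
  | succ k ih =>
    rw [add_mul, one_mul]
    exact of_exact (injective_quotPowMul hx k) (surjective_quotPowProj x k) (exact_quotPow x k) ih h

/-- Raise one element at a time. Permutability of regular sequences in a local ring makes x regular
modulo the others, so passing from x to x^k stacks k copies of the old quotient; then xs is still
regular on N/x^kN and the induction continues. -/
theorem quotient_ofList_pow [IsLocalRing R] [IsNoetherianRing R] {xs : List R}
    (hm : ∀ x ∈ xs, x ∈ IsLocalRing.maximalIdeal R) {k : ℕ} (hk : k ≠ 0) (N : Type v)
    [AddCommGroup N] [Module R N] [Module.Finite R N] (reg : IsWeaklyRegular N xs) {c : ℕ}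
    (h : HasLengthBounds R J L H c (N ⧸ (Ideal.ofList xs • (⊤ : Submodule R N)))) :
    HasLengthBounds R J L H (k ^ xs.length * c)
      (N ⧸ (Ideal.ofList (xs.map (· ^ k)) • (⊤ : Submodule R N))) := by
  induction xs generalizing N c with
  | nil =>
    rw [List.map_nil, List.length_nil, pow_zero, one_mul]
    exact h
  | cons x xs ih =>
    have hperm : (x :: xs).Perm (xs ++ [x]) := (List.perm_append_singleton x xs).symm
    have reg' := (isWeaklyRegular_append_iff N xs [x]).mp
      (IsLocalRing.isWeaklyRegular_of_perm_of_subset_maximalIdeal reg hperm hm)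
    have hx := (isWeaklyRegular_singleton_iff _ _).mp reg'.2
    have regk : IsWeaklyRegular N (x ^ k :: xs) := by
      refine IsLocalRing.isWeaklyRegular_of_perm_of_subset_maximalIdeal
        ((isWeaklyRegular_append_iff N xs [x ^ k]).mpr
          ⟨reg'.1, (isWeaklyRegular_singleton_iff _ _).mpr (hx.pow k)⟩)
        (List.perm_append_singleton (x ^ k) xs) ?_
      intro r hr
      rw [List.mem_append, List.mem_singleton] at hr
      rcases hr with hr | rfl
      · exact hm r (List.mem_cons_of_mem _ hr)
      -- Here k ≠ 0 matters: permuting needs x^k in the maximal ideal.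
      · exact Ideal.pow_mem_of_mem _ (hm x List.mem_cons_self) k (Nat.pos_of_ne_zero hk)
    have h1 := (h.congr (Submodule.quotOfListConsSMulTopEquivQuotSMulTopOuter N x xs)
      ).quotSMulTop_pow hx k
    have h2 := ih (fun r hr => hm r (List.mem_cons_of_mem _ hr)) (QuotSMulTop (x ^ k) N)
      ((isWeaklyRegular_cons_iff N (x ^ k) xs).mp regk).2
      (h1.congr ((Submodule.quotOfListConsSMulTopEquivQuotSMulTopOuter N (x ^ k) xs).symm.trans
        (Submodule.quotOfListConsSMulTopEquivQuotSMulTopInner N (x ^ k) xs)))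
    rw [List.length_cons, pow_succ, mul_assoc, List.map_cons]
    exact h2.congr (Submodule.quotOfListConsSMulTopEquivQuotSMulTopInner N (x ^ k) _).symm

end HasLengthBounds

end Powers

/-! ### Polynomial growth of lengths, and the error term. -/

section Growth

open IsLocalRing
open scoped Pointwise

variable {R : Type u} [CommRing R]

theorem ofList_pow_le_ofList_map_pow (xs : List R) (k : ℕ) :
    Ideal.ofList xs ^ (xs.length * k + 1) ≤ Ideal.ofList (xs.map (· ^ k)) := by
  induction xs with
  | nil => simp
  | cons x xs ih =>
    rw [Ideal.ofList_cons, List.map_cons, Ideal.ofList_cons, List.length_cons,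
      show (xs.length + 1) * k + 1 = k + (xs.length * k + 1) by ring]
    exact Ideal.sup_pow_add_le_pow_sup_pow.trans
      (sup_le_sup (Ideal.span_singleton_pow x k).le ih)

/-- Parameters chosen inside 𝔞: at most m elements generating an ideal of height at least m, so no
non-maximal prime contains them. -/
theorem exists_ofList_le_isFiniteLength [IsLocalRing R] [IsNoetherianRing R] {𝔞 : Ideal R}
    (h𝔞 : 𝔞 ≠ ⊤) (hfin : IsFiniteLength R (R ⧸ 𝔞)) {m : ℕ} (hm : ringKrullDim R = m) :
    ∃ ys : List R, ys.length ≤ m ∧ Ideal.ofList ys ≤ 𝔞 ∧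
      IsFiniteLength R (R ⧸ Ideal.ofList ys) := by
  have hh := height_eq_ringKrullDim_of_isFiniteLength h𝔞 hfin
  rw [hm] at hh
  have hh' : 𝔞.height = (m : ℕ∞) := by exact_mod_cast hh
  obtain ⟨K, hK𝔞, hrank, hKm⟩ := exists_spanRank_le_and_le_height_of_le_height 𝔞 m hh'.ge
  have hfg : Submodule.FG K := IsNoetherian.noetherian K
  obtain ⟨s, hs, hspan⟩ := Submodule.FG.exists_span_finset_card_eq_spanFinrank hfg
  have hlist : Ideal.ofList s.toList = K := by
    rw [Ideal.ofList, ← hspan]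
    congr 1
    ext x
    exact Finset.mem_toList
  refine ⟨s.toList, ?_, hlist ▸ hK𝔞, ?_⟩
  · rw [Finset.length_toList, hs, ← Nat.cast_le (α := Cardinal),
      ← Submodule.fg_iff_spanRank_eq_spanFinrank.mpr hfg]
    exact hrank
  · rw [hlist]
    refine isFiniteLength_quotient_of_forall_prime fun p hp hKp => ?_
    by_contra hne
    have hlt : p < maximalIdeal R := lt_of_le_of_ne (le_maximalIdeal hp.ne_top) hne
    have h1 := Ideal.height_add_one_le_of_lt_of_isPrime hlt
    have h2 : (maximalIdeal R).height = (m : ℕ∞) := by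
      have := maximalIdeal_height_eq_ringKrullDim (R := R)
      rw [hm] at this
      exact_mod_cast this
    rw [h2] at h1
    have h3 := (add_le_add_left (hKm.trans (Ideal.height_mono hKp)) 1).trans h1
    exact absurd h3 (by exact_mod_cast Nat.not_succ_le_self m)

/-- With N = |xs| and at most m parameters ys inside (xs), the pigeonhole inclusion (xs)^(Nk+1) ≤
(xs^k) puts each y^(Nk+1) in (xs^k). The length is thus at most (Nk+1)^m·l ≤ (N+1)^m·l·k^m, where l
= λ(R/(ys)). -/
theorem exists_length_quotient_ofList_pow_le [IsLocalRing R] [IsNoetherianRing R] {xs : List R}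
    (hxs : Ideal.ofList xs ≠ ⊤) (hfin : IsFiniteLength R (R ⧸ Ideal.ofList xs)) {m : ℕ}
    (hm : ringKrullDim R = m) :
    ∃ c : ℕ, ∀ k ≠ 0,
      Module.length R (R ⧸ Ideal.ofList (xs.map (· ^ k))) ≤ (c * k ^ m : ℕ) := by
  obtain ⟨ys, hlen, hle, hys⟩ := exists_ofList_le_isFiniteLength hxs hfin hm
  have hne := Module.length_ne_top_iff.mpr hys
  obtain ⟨l, hl⟩ := ENat.ne_top_iff_exists.mp hne
  refine ⟨(xs.length + 1) ^ m * l, fun k hk => ?_⟩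
  have hpow : Ideal.ofList (ys.map (· ^ (xs.length * k + 1))) ≤
      Ideal.ofList (xs.map (· ^ k)) := by
    refine Ideal.span_le.mpr ?_
    intro y hy
    obtain ⟨z, hz, rfl⟩ := List.mem_map.mp hy
    exact ofList_pow_le_ofList_map_pow xs k
      (Ideal.pow_mem_pow (hle (Ideal.subset_span hz)) _)
  refine (Module.length_le_of_surjective _ (Submodule.factor_surjective hpow)).trans ?_
  have h := length_quotient_ofList_pow_le ys (xs.length * k + 1) R
  rw [smul_eq_mul, Ideal.mul_top, smul_eq_mul, Ideal.mul_top, ← hl] at h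
  refine h.trans ?_
  rw [← Nat.cast_mul, Nat.cast_le, mul_right_comm, ← mul_pow]
  refine Nat.mul_le_mul_right _ ?_
  refine (Nat.pow_le_pow_right (Nat.succ_pos _) hlen).trans (Nat.pow_le_pow_left ?_ _)
  rw [add_mul, one_mul]
  exact Nat.add_le_add_left (Nat.one_le_iff_ne_zero.mpr hk) _

theorem length_ker_lsmul_eq {M : Type v} [AddCommGroup M] [Module R M]
    (hM : Module.length R M ≠ ⊤) (s : R) :
    Module.length R (LinearMap.ker (LinearMap.lsmul R M s)) =
      Module.length R (QuotSMulTop s M) := by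
  have h1 := Module.length_eq_add_of_exact (LinearMap.ker (LinearMap.lsmul R M s)).subtype
    (LinearMap.lsmul R M s).rangeRestrict (Submodule.injective_subtype _)
    (LinearMap.surjective_rangeRestrict _) (by
      intro x
      rw [Submodule.coe_subtype, Subtype.range_coe, SetLike.mem_coe, LinearMap.mem_ker]
      exact Subtype.ext_iff)
  have h2 := Module.length_eq_add_of_exact (LinearMap.range (LinearMap.lsmul R M s)).subtype
    (LinearMap.range (LinearMap.lsmul R M s)).mkQ (Submodule.injective_subtype _)
    (Submodule.mkQ_surjective _) (LinearMap.exact_subtype_mkQ _)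
  have h3 : LinearMap.range (LinearMap.lsmul R M s) = s • (⊤ : Submodule R M) :=
    LinearMap.range_eq_map _
  rw [h2] at h1
  have h4 : Module.length R (LinearMap.range (LinearMap.lsmul R M s)) ≠ ⊤ :=
    ne_top_of_le_ne_top hM (Module.length_le_of_injective _ (Submodule.injective_subtype _))
  refine ((WithTop.add_left_inj h4).mp (h1.trans (add_comm _ _))).symm.trans ?_
  rw [h3]

/-- Pull back along h. A map ψ that vanishes on the range of h satisfies sψ = 0, so its d components
lie in the kernel of s on X, which has the same length as X/sX. -/
theorem mul_length_le_of_smul_mem_range {J : Ideal R} {d : ℕ} {h : J →ₗ[R] (Fin d → R ⧸ J)} {s : R}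
    (hs : ∀ v, s • v ∈ LinearMap.range h) {X : Type v} [AddCommGroup X] [Module R X]
    (hX : Module.length R X ≠ ⊤) (hJ : ∀ a ∈ J, ∀ x : X, a • x = 0) :
    d * Module.length R X ≤
      Module.length R (J →ₗ[R] X) + d * Module.length R (QuotSMulTop s X) := by
  let e : ((Fin d → R ⧸ J) →ₗ[R] X) ≃ₗ[R] (Fin d → X) :=
    (LinearMap.lsum R (fun _ => R ⧸ J) R).symm.trans
      (LinearEquiv.piCongrRight fun _ => linearMapQuotientEquiv J X hJ)
  let θ : ((Fin d → R ⧸ J) →ₗ[R] X) →ₗ[R] (J →ₗ[R] X) := LinearMap.lcomp R X h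
  have h1 : Module.length R ((Fin d → R ⧸ J) →ₗ[R] X) = d * Module.length R X := by
    rw [e.length_eq, Module.length_pi_of_fintype]
    simp
  let K := LinearMap.ker (LinearMap.lsmul R X s)
  let ι : LinearMap.ker θ →ₗ[R] (Fin d → K) :=
    LinearMap.pi fun i => ((LinearMap.proj i ∘ₗ e.toLinearMap) ∘ₗ
      (LinearMap.ker θ).subtype).codRestrict K fun ψ => by
        have h0 : ψ.1 (s • Pi.single i 1) = 0 := by
          obtain ⟨j, hj⟩ := hs (Pi.single i 1)
          rw [← hj]
          exact LinearMap.congr_fun ψ.2 j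
        rw [map_smul] at h0
        exact h0
  have hι : Function.Injective ι := by
    intro φ ψ hφψ
    refine Subtype.ext (e.injective (funext fun i => ?_))
    exact congrArg Subtype.val (congrFun hφψ i)
  have h2 := Module.length_le_of_injective ι hι
  rw [Module.length_pi_of_fintype] at h2
  rw [← h1, ← length_ker_lsmul_eq hX, add_comm]
  refine (length_le_add_of_exact (R := R) (N := LinearMap.ker θ)
    (M := (Fin d → R ⧸ J) →ₗ[R] X) (P := J →ₗ[R] X) (f := (LinearMap.ker θ).subtype) (g := θ)
    θ.exact_subtype_ker_map).trans ?_
  refine add_le_add_left (h2.trans_eq ?_) _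
  simp [K]

end Growth

/-! ### A map J → (Q/J)^d that is onto at one prime. -/

section GenericSurjection

open IsLocalRing

variable {Q : Type u} [CommRing Q] [IsNoetherianRing Q]

theorem length_le_length_of_ofList_le [IsLocalRing Q] {zs ws : List Q} (regz : IsRegular Q zs)
    (regw : IsRegular Q ws) (h : Ideal.ofList zs ≤ Ideal.ofList ws) :
    zs.length ≤ ws.length := by
  have h1 := ringKrullDim_add_length_eq_ringKrullDim_of_isRegular zs regz
  have h2 := ringKrullDim_add_length_eq_ringKrullDim_of_isRegular ws regw
  have h3 := ringKrullDim_le_of_surjective (Ideal.Quotient.factor h)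
    (Ideal.Quotient.factor_surjective h)
  have hdim (us : List Q) (reg : IsRegular Q us) :
      ∃ n : ℕ, ringKrullDim (Q ⧸ Ideal.ofList us) = n := by
    have : Nontrivial (Q ⧸ Ideal.ofList us) := Ideal.Quotient.nontrivial_iff.mpr fun e =>
      (maximalIdeal.isMaximal Q).ne_top (top_le_iff.mp (e ▸ mem_maximalIdeal_of_isRegular reg))
    have : IsLocalRing (Q ⧸ Ideal.ofList us) :=
      IsLocalRing.of_surjective' _ Ideal.Quotient.mk_surjective
    exact exists_ringKrullDim_eq_natCast _
  obtain ⟨a, ha⟩ := hdim zs regz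
  obtain ⟨b, hb⟩ := hdim ws regw
  rw [← h2, ha, hb] at h1
  rw [ha, hb] at h3
  have h1' : a + zs.length = b + ws.length := by exact_mod_cast h1
  have h3' : b ≤ a := by exact_mod_cast h3
  omega

/-- Comparing dimensions, the regular sequence ws generating J_q has at least |zs| terms. The
coordinate maps dual to the first |zs| of them are jointly onto, and a denominator can be cleared
since J is finitely presented. -/
theorem exists_linearMap_localized_surjective {J q : Ideal Q} [q.IsPrime] (hJq : J ≤ q)
    {zs : List Q} (reg : IsWeaklyRegular Q zs) (hz : Ideal.ofList zs ≤ J)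
    (hCI : IsCompleteIntersectionIdeal (J.map (algebraMap Q (Localization.AtPrime q)))) :
    ∃ h : J →ₗ[Q] (Fin zs.length → Q ⧸ J), ∀ v, ∃ t ∉ q, t • v ∈ LinearMap.range h := by
  let A := Localization.AtPrime q
  let 𝔧 : Ideal A := J.localized' A q.primeCompl (Algebra.linearMap Q A)
  have h𝔧 : J.map (algebraMap Q A) = 𝔧 := 
    (Ideal.localized'_eq_map A q.primeCompl J).symm
  have hmem (j : J) : algebraMap Q A j ∈ 𝔧 := h𝔧 ▸ Ideal.mem_map_of_mem _ j.2
  obtain ⟨ws, regw, hws⟩ := hCI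
  rw [h𝔧] at hws
  have regz : IsRegular A (zs.map (algebraMap Q A)) :=
    reg.isRegular_of_isLocalization_of_mem A q fun r hr => hJq (hz (Ideal.subset_span hr))
  have hlen : zs.length ≤ ws.length := by
    rw [← List.length_map (f := algebraMap Q A) (as := zs)]
    refine length_le_length_of_ofList_le regz regw ?_
    rw [← hws, ← h𝔧, ← Ideal.map_ofList]
    exact Ideal.map_mono hz
  let f₀ : (Q ⧸ J) →ₗ[Q] (A ⧸ 𝔧) := J.toLocalizedQuotient' A q.primeCompl (Algebra.linearMap Q A)
  let f : (Fin zs.length → Q ⧸ J) →ₗ[Q] (Fin zs.length → A ⧸ 𝔧) :=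
    LinearMap.pi fun i => f₀ ∘ₗ LinearMap.proj i
  have hf : IsLocalizedModule q.primeCompl f := inferInstance
  have hsurj : Function.Surjective (evalOfList ws (A ⧸ 𝔧)) :=
    surjective_evalOfList regw.toIsWeaklyRegular _ fun a ha x =>
      smul_quotient_eq_zero (hws ▸ ha) x
  choose φ hφ using fun i : Fin zs.length =>
    hsurj (Pi.single (Fin.castLE hlen i) (Ideal.Quotient.mk 𝔧 1))
  let w (i : Fin zs.length) : Ideal.ofList ws :=
    ⟨ws[Fin.castLE hlen i], Ideal.subset_span (ws.getElem_mem _)⟩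
  have hφw (i i') : φ i (w i') = if i = i' then 1 else 0 := by
    refine (congrFun (hφ i) (Fin.castLE hlen i')).trans ?_
    rw [Pi.single_apply]
    simp only [(Fin.castLE_injective hlen).eq_iff, eq_comm, map_one]
  let g₀ : J →ₗ[Q] Ideal.ofList ws :=
    { toFun := fun j => ⟨algebraMap Q A j, hws ▸ hmem j⟩
      map_add' := fun x y => Subtype.ext (map_add _ _ _)
      map_smul' := fun c x => Subtype.ext ((map_mul _ _ _).trans (Algebra.smul_def _ _).symm) }
  let g : J →ₗ[Q] (Fin zs.length → A ⧸ 𝔧) :=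
    LinearMap.pi fun i => (φ i).restrictScalars Q ∘ₗ g₀
  have hg₀ (y : Ideal.ofList ws) : ∃ t : q.primeCompl, ∃ j, g₀ j = t • y := by
    have hy : (y : A) ∈ 𝔧 := hws.ge y.2
    obtain ⟨j, hj, t, ht⟩ :=
      (Submodule.mem_localized' A q.primeCompl (Algebra.linearMap Q A) J _).mp hy
    refine ⟨t, ⟨j, hj⟩, Subtype.ext ?_⟩
    exact (IsLocalizedModule.mk'_eq_iff.mp ht)
  have : Module.FinitePresentation Q J := Module.finitePresentation_of_finite Q J
  obtain ⟨h, s, hs⟩ := Module.FinitePresentation.exists_lift_of_isLocalizedModule q.primeCompl f g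
  refine ⟨h, fun v => ?_⟩
  choose a ha using fun i => Ideal.Quotient.mk_surjective (f v i)
  let y : Ideal.ofList ws := ∑ i, a i • w i
  have hy (i) : φ i y = f v i := by
    rw [← ha, map_sum, Finset.sum_eq_single i]
    · rw [map_smul, hφw, if_pos rfl]
      change Ideal.Quotient.mk 𝔧 (a i * 1) = _
      rw [mul_one]
    · intro i' _ hne
      rw [map_smul, hφw, if_neg hne.symm, smul_zero]
    · simp
  obtain ⟨t, j, hj⟩ := hg₀ y
  have h1 : f (h j) = f ((s * t) • v) := by
    refine (LinearMap.congr_fun hs j).trans ?_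
    funext i
    change s • φ i (g₀ j) = f ((s * t) • v) i
    rw [hj, LinearMap.map_smul_of_tower, hy, LinearMap.map_smul_of_tower, Pi.smul_apply, mul_smul]
  obtain ⟨c, hc⟩ := IsLocalizedModule.exists_of_eq (S := q.primeCompl) h1
  refine ⟨c * (s * t), (c * (s * t)).2, c • j, ?_⟩
  rw [LinearMap.map_smul_of_tower, hc, smul_smul]
  rfl

end GenericSurjection

/-! ### Gluing over the associated primes. -/

section Gluing

variable {Q : Type u} [CommRing Q] {M N : Type*} [AddCommGroup M] [Module Q M] [AddCommGroup N]
  [Module Q N]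

/-- Modulo q the map h' is e·h with e a unit at q, so h' is onto at q by Nakayama, here in the form
Supp(C/qC) = Supp C ∩ V(q). -/
theorem not_annihilator_quotient_range_le [Module.Finite Q N] {q : Ideal Q} [q.IsPrime]
    {h h' : M →ₗ[Q] N} (hh : ∀ v, ∃ t ∉ q, t • v ∈ LinearMap.range h)
    {e : Q} (he : e ∉ q) (hcong : ∀ x, h' x - e • h x ∈ q • (⊤ : Submodule Q N)) :
    ¬ Module.annihilator Q (N ⧸ LinearMap.range h') ≤ q := by
  let C := N ⧸ LinearMap.range h'
  intro hle
  have hsupp : (⟨q, inferInstance⟩ : PrimeSpectrum Q) ∈ Module.support Q C := by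
    rw [Module.support_eq_zeroLocus]
    exact hle
  have hsupp2 : (⟨q, inferInstance⟩ : PrimeSpectrum Q) ∈
      Module.support Q (C ⧸ (q • (⊤ : Submodule Q C))) := by
    rw [Module.support_quotient]
    exact ⟨hsupp, le_refl q⟩
  rw [Module.mem_support_iff'] at hsupp2
  obtain ⟨c, hc⟩ := hsupp2
  obtain ⟨c, rfl⟩ := Submodule.mkQ_surjective _ c
  obtain ⟨v, rfl⟩ := Submodule.mkQ_surjective _ c
  obtain ⟨t, ht, x, hx⟩ := hh v
  refine hc (e * t) (fun hmem => (Ideal.IsPrime.mem_or_mem inferInstance hmem).elim he ht) ?_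
  rw [← map_smul, ← map_smul, Submodule.mkQ_apply, Submodule.Quotient.mk_eq_zero, mul_smul, ← hx]
  have h1 : (LinearMap.range h').mkQ (e • h x) = -(LinearMap.range h').mkQ (h' x - e • h x) := by
    have h0 : (LinearMap.range h').mkQ (h' x) = 0 :=
      (Submodule.Quotient.mk_eq_zero _).mpr (LinearMap.mem_range_self h' x)
    rw [map_sub, h0, zero_sub, neg_neg]
  rw [h1]
  refine neg_mem (Submodule.smul_top_le_comap_smul_top q (LinearMap.range h').mkQ (hcong x))

/-- Among maximal associated primes choose e_q outside q but inside all the others. Then ∑ e_q η_q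
is congruent to e_q η_q modulo q, so its cokernel vanishes at each q, and prime avoidance finds an
annihilator outside every associated prime. -/
theorem exists_linearMap_smul_mem_range [IsNoetherianRing Q] [Module.Finite Q N] {P : Type*}
    [AddCommGroup P] [Module Q P] [Module.Finite Q P]
    (hloc : ∀ q ∈ associatedPrimes Q P,
      ∃ h : M →ₗ[Q] N, ∀ v, ∃ t ∉ q, t • v ∈ LinearMap.range h) :
    ∃ (h : M →ₗ[Q] N) (s : Q), IsSMulRegular P s ∧ ∀ v, s • v ∈ LinearMap.range h := by
  classical
  have hfin := associatedPrimes.finite Q P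
  let T : Finset (Ideal Q) := hfin.toFinset.filter (Maximal (· ∈ associatedPrimes Q P))
  have hT {q} (hq : q ∈ T) : Maximal (· ∈ associatedPrimes Q P) q := (Finset.mem_filter.mp hq).2
  have hprime {q} (hq : q ∈ T) : q.IsPrime := (hT hq).1.isPrime
  choose! η hη using hloc
  have he : ∀ q ∈ T, ∃ e, (∀ q' ∈ T, q' ≠ q → e ∈ q') ∧ e ∉ q := by
    intro q hq
    have := hprime hq
    by_contra! hcon
    have hle : (T.erase q).inf id ≤ q := fun e he => hcon e fun q' hq' hne =>
      (Submodule.mem_finsetInf.mp he) q' (Finset.mem_erase.mpr ⟨hne, hq'⟩)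
    obtain ⟨q', hq', hle'⟩ := (Ideal.IsPrime.inf_le' inferInstance).mp hle
    obtain ⟨hne, hq'⟩ := Finset.mem_erase.mp hq'
    exact hne ((hT hq').eq_of_le (hT hq).1 hle')
  choose! e he using he
  let h : M →ₗ[Q] N := ∑ q ∈ T, e q • η q
  have hnot : ∀ q ∈ T, ¬ Module.annihilator Q (N ⧸ LinearMap.range h) ≤ q := by
    intro q hq
    have := hprime hq
    refine not_annihilator_quotient_range_le (hη q (hT hq).1) (he q hq).2 fun x => ?_
    rw [LinearMap.sum_apply, ← Finset.add_sum_erase _ _ hq, LinearMap.smul_apply,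
      add_sub_cancel_left]
    refine Submodule.sum_mem _ fun q' hq' => ?_
    obtain ⟨hne, hq'⟩ := Finset.mem_erase.mp hq'
    exact Submodule.smul_mem_smul ((he q' hq').1 q hq hne.symm) trivial
  have havoid : ¬ ((Module.annihilator Q (N ⧸ LinearMap.range h) : Set Q) ⊆
      ⋃ q ∈ (T : Set (Ideal Q)), (q : Set Q)) := by
    -- The two exceptional indices of prime avoidance are placeholders: every member of `T` is
    -- prime.
    rw [Ideal.subset_union_prime ⊥ ⊥ (fun q hq _ _ => hprime hq)]
    rintro ⟨q, hq, hle⟩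
    exact hnot q hq hle
  obtain ⟨s, hs, hsT⟩ := Set.not_subset.mp havoid
  refine ⟨h, s, ?_, fun v => ?_⟩
  · by_contra hreg
    have hmem : s ∈ ⋃ p ∈ associatedPrimes Q P, (p : Set Q) := by
      rw [biUnion_associatedPrimes_eq_compl_regular]
      exact hreg
    obtain ⟨p, hp, hsp⟩ := Set.mem_iUnion₂.mp hmem
    obtain ⟨q, hpq, hq⟩ := hfin.exists_le_maximal hp
    exact hsT (Set.mem_iUnion₂.mpr
      ⟨q, Finset.mem_filter.mpr ⟨hfin.mem_toFinset.mpr hq.1, hq⟩, hpq hsp⟩)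
  · rw [← Submodule.Quotient.mk_eq_zero, Submodule.Quotient.mk_smul]
    exact Module.mem_annihilator.mp hs _

end Gluing

section Generic

theorem IsGenericallyCompleteIntersection.exists_linearMap {Q : Type u} [CommRing Q]
    [IsNoetherianRing Q] {J : Ideal Q} (hJ : IsGenericallyCompleteIntersection J) {zs : List Q}
    (reg : IsWeaklyRegular Q zs) (hz : Ideal.ofList zs ≤ J) :
    ∃ (h : J →ₗ[Q] (Fin zs.length → Q ⧸ J)) (s : Q),
      IsSMulRegular (Q ⧸ J) s ∧ ∀ v, s • v ∈ LinearMap.range h := by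
  refine exists_linearMap_smul_mem_range fun q hq => ?_
  have := hq.isPrime
  refine exists_linearMap_localized_surjective ?_ reg hz (hJ q hq)
  intro j hj
  refine (IsAssociatedPrime.annihilator_le hq) ?_
  exact Module.mem_annihilator.mpr fun x => Subtype.ext (smul_quotient_eq_zero hj x.1)

end Generic

/-! ### Case 2: smoothable pairs. -/

section Smoothable

open IsLocalRing
open scoped Pointwise

theorem exists_quotient_sup_equiv {Q : Type u} [CommRing Q] (J 𝔞 : Ideal Q) :
    Nonempty ((Q ⧸ (J ⊔ 𝔞)) ≃ₗ[Q] ((Q ⧸ J) ⧸ (𝔞 • (⊤ : Submodule Q (Q ⧸ J))))) := by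
  let f : Q →ₗ[Q] ((Q ⧸ J) ⧸ (𝔞 • (⊤ : Submodule Q (Q ⧸ J)))) :=
    Submodule.mkQ _ ∘ₗ J.mkQ
  have hf : Function.Surjective f := (Submodule.mkQ_surjective _).comp J.mkQ_surjective
  have hker : LinearMap.ker f = J ⊔ 𝔞 := by
    have h : 𝔞 • (⊤ : Submodule Q (Q ⧸ J)) = Submodule.map J.mkQ 𝔞 := by
      have h1 := Submodule.map_smul'' 𝔞 (⊤ : Submodule Q Q) J.mkQ
      rw [smul_eq_mul, Ideal.mul_top, Submodule.map_top, Submodule.range_mkQ] at h1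
      exact h1.symm
    rw [LinearMap.ker_comp, Submodule.ker_mkQ, h, Submodule.comap_map_eq, Submodule.ker_mkQ,
      sup_comm]
  exact ⟨(Submodule.quotEquivOfEq _ _ hker.symm).trans (f.quotKerEquivOfSurjective hf)⟩

/-- Regularity on Q/J keeps J/(xs)J → Q/(xs) injective, that is, J ∩ (xs) = (xs)J. -/
theorem mem_ofList_smul_top_of_isWeaklyRegular {Q : Type u} [CommRing Q] {J : Ideal Q}
    {xs : List Q} (reg : IsWeaklyRegular (Q ⧸ J) xs) {j : J} (hj : (j : Q) ∈ Ideal.ofList xs) :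
    j ∈ Ideal.ofList xs • (⊤ : Submodule Q J) := by
  have h := map_first_exact_on_four_term_right_exact_of_isSMulRegular_last
    (f₁ := (0 : PUnit.{u + 1} →ₗ[Q] J)) (f₂ := Submodule.subtype J) (f₃ := Submodule.mkQ J)
    (by
      intro x
      rw [Submodule.coe_subtype, Submodule.coe_eq_zero]
      exact ⟨fun h => ⟨PUnit.unit, h.symm⟩, fun ⟨_, h⟩ => h.symm⟩)
    (LinearMap.exact_subtype_mkQ J) (Submodule.mkQ_surjective J) reg
  obtain ⟨y, hy⟩ := (h (Submodule.Quotient.mk j)).mp (by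
    refine (Submodule.Quotient.mk_eq_zero _).mpr ?_
    rw [smul_eq_mul, Ideal.mul_top]
    exact hj)
  obtain ⟨y, rfl⟩ := Submodule.mkQ_surjective _ y
  exact (Submodule.Quotient.mk_eq_zero _).mp hy.symm

/-- Multiplying by k and cancelling k^n leaves k·dL ≤ k·H + dc. If dL ≥ H + 1 this fails at k = dc +
1, so one value of k suffices and no limit is taken. -/
theorem mul_le_of_forall_pow_mul_le {d n c : ℕ} {L H : ℕ∞} {E : ℕ → ℕ∞} (hL : L ≠ ⊤)
    (hE : ∀ k ≠ 0, k * E k ≤ (c * k ^ n : ℕ))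
    (h : ∀ k ≠ 0, d * ((k ^ n : ℕ) * L) ≤ (k ^ n : ℕ) * H + d * E k) : d * L ≤ H := by
  rcases eq_or_ne H ⊤ with rfl | hH
  · exact le_top
  lift L to ℕ using hL
  lift H to ℕ using hH
  let k := d * c + 1
  have hk : k ≠ 0 := Nat.succ_ne_zero _
  have hEk : E k ≠ ⊤ := by
    intro htop
    have := hE k hk
    rw [htop, ENat.mul_top (Nat.cast_ne_zero.mpr hk), top_le_iff] at this
    exact ENat.natCast_ne_top _ this
  have h1 := hE k hk
  have h2 := h k hk
  lift E k to ℕ using hEk with E₀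
  have h1' : k * E₀ ≤ c * k ^ n := by exact_mod_cast h1
  have h2' : d * (k ^ n * L) ≤ k ^ n * H + d * E₀ := by exact_mod_cast h2
  suffices hsuff : d * L ≤ H by exact_mod_cast hsuff
  by_contra! hlt
  have h3 : k ^ n * (k * (d * L)) ≤ k ^ n * (k * H + d * c) := by
    calc k ^ n * (k * (d * L)) = k * (d * (k ^ n * L)) := by ring
      _ ≤ k * (k ^ n * H + d * E₀) := Nat.mul_le_mul_left _ h2'
      _ = k ^ n * (k * H) + d * (k * E₀) := by ring
      _ ≤ k ^ n * (k * H) + d * (c * k ^ n) := by gcongr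
      _ = k ^ n * (k * H + d * c) := by ring
  have h4 := Nat.le_of_mul_le_mul_left h3 (Nat.pow_pos (Nat.pos_of_ne_zero hk))
  have h5 : k * (H + 1) ≤ k * (d * L) := Nat.mul_le_mul_left _ hlt
  have h6 : k = d * c + 1 := rfl
  rw [mul_add, mul_one] at h5
  omega

/-- The quotient is a quotient of T/(xs^k) for T = S/sS. As s is a nonzerodivisor, dim T ≤ |xs| − 1,
so its length is O(k^(|xs|-1)). A unit s is split off because T would then be zero. -/
theorem exists_mul_length_quotSMulTop_le {Q : Type u} [CommRing Q] [IsLocalRing Q]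
    [IsNoetherianRing Q] {J : Ideal Q} {xs : List Q} (reg : IsRegular (Q ⧸ J) xs)
    (hfin : IsFiniteLength Q (Q ⧸ (J ⊔ Ideal.ofList xs))) {s : Q} (hs : IsSMulRegular (Q ⧸ J) s) :
    ∃ c : ℕ, ∀ k : ℕ, k ≠ 0 → k * Module.length Q (QuotSMulTop s
      ((Q ⧸ J) ⧸ (Ideal.ofList (xs.map (· ^ k)) • (⊤ : Submodule Q (Q ⧸ J))))) ≤
        (c * k ^ xs.length : ℕ) := by
  by_cases hunit : IsUnit s
  · refine ⟨0, fun k _ => ?_⟩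
    obtain ⟨s, rfl⟩ := hunit
    have : Subsingleton (QuotSMulTop (s : Q)
        ((Q ⧸ J) ⧸ (Ideal.ofList (xs.map (· ^ k)) • (⊤ : Submodule Q (Q ⧸ J))))) := by
      rw [Submodule.Quotient.subsingleton_iff, eq_top_iff]
      intro x _
      exact ⟨(↑s⁻¹ : Q) • x, trivial, smul_inv_smul s x⟩
    rw [Module.length_eq_zero, mul_zero]
    exact bot_le
  have hnt : Nontrivial (Q ⧸ J) := reg.nontrivial
  let S := Q ⧸ J
  have hloc : IsLocalRing S := IsLocalRing.of_surjective' _ Ideal.Quotient.mk_surjective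
  have hlh : IsLocalHom (algebraMap Q S) := IsLocalHom.of_surjective _ Ideal.Quotient.mk_surjective
  let T := S ⧸ Ideal.span {algebraMap Q S s}
  have hST : Function.Surjective (algebraMap S T) := Ideal.Quotient.mk_surjective
  have hQT : Function.Surjective (algebraMap Q T) := hST.comp Ideal.Quotient.mk_surjective
  have hTnt : Nontrivial T := by
    rw [Ideal.Quotient.nontrivial_iff, Ne, Ideal.span_singleton_eq_top, isUnit_map_iff]
    exact hunit
  have hTloc : IsLocalRing T := IsLocalRing.of_surjective' _ hST
  have hTlh : IsLocalHom (algebraMap Q T) := IsLocalHom.of_surjective _ hQT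
  obtain ⟨m, hm⟩ := exists_ringKrullDim_eq_natCast T
  have hxs : ∀ x ∈ xs, x ∈ maximalIdeal Q := by
    intro x hx
    have hne : Ideal.ofList xs ≠ ⊤ := fun htop => reg.2 (by rw [htop, Submodule.top_smul])
    exact le_maximalIdeal hne (Ideal.subset_span hx)
  have hsupne : J ⊔ Ideal.ofList xs ≠ ⊤ := by
    intro htop
    refine (maximalIdeal.isMaximal Q).ne_top (top_le_iff.mp (htop ▸ sup_le ?_ ?_))
    · exact le_maximalIdeal (Ideal.Quotient.nontrivial_iff.mp hnt)
    · exact Ideal.span_le.mpr hxs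
  have hdimS : ringKrullDim S = xs.length := by
    have regS : IsRegular S (xs.map (algebraMap Q S)) := by
      refine IsRegular.of_isWeaklyRegular_of_mem_maximalIdeal S ?_
        ((isWeaklyRegular_map_algebraMap_iff S S xs).mpr reg.toIsWeaklyRegular)
      intro r hr
      obtain ⟨x, hx, rfl⟩ := List.mem_map.mp hr
      exact map_nonunit (algebraMap Q S) x (hxs x hx)
    rw [← ringKrullDim_add_length_eq_ringKrullDim_of_isRegular _ regS, List.length_map,
      ← Ideal.map_ofList, (ringKrullDim_eq_of_ringEquiv
        (DoubleQuot.quotQuotEquivQuotSup J (Ideal.ofList xs)) :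
          ringKrullDim (S ⧸ (Ideal.ofList xs).map (algebraMap Q S)) = _),
      ringKrullDim_quotient_eq_zero hsupne hfin, zero_add]
  have hmn : m + 1 ≤ xs.length := by
    have hnzd : algebraMap Q S s ∈ nonZeroDivisors S := by
      rw [mem_nonZeroDivisors_iff_right]
      intro x hx
      refine hs.right_eq_zero_of_smul ?_
      rw [Algebra.smul_def, mul_comm]
      exact hx
    have h := ringKrullDim_quotient_succ_le_of_nonZeroDivisor hnzd
    rw [hdimS] at h
    have h' : (m : WithBot ℕ∞) + 1 ≤ xs.length := hm ▸ h
    exact_mod_cast h'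
  have hsurj (k : ℕ) : ∃ ρ : (Q ⧸ (Ideal.ofList ((xs.map (algebraMap Q T)).map (· ^ k))).comap
      (algebraMap Q T)) →ₗ[Q] QuotSMulTop s
      ((Q ⧸ J) ⧸ (Ideal.ofList (xs.map (· ^ k)) • (⊤ : Submodule Q (Q ⧸ J)))),
      Function.Surjective ρ := by
    let U := Ideal.ofList (xs.map (· ^ k)) • (⊤ : Submodule Q (Q ⧸ J))
    let f : Q →ₗ[Q] QuotSMulTop s ((Q ⧸ J) ⧸ U) := Submodule.mkQ _ ∘ₗ U.mkQ ∘ₗ J.mkQ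
    have hf : Function.Surjective f :=
      (Submodule.mkQ_surjective _).comp (U.mkQ_surjective.comp J.mkQ_surjective)
    have hsmul (a b : Q) : f (a * b) = a • f b := map_smul f a b
    have hle : (Ideal.ofList ((xs.map (algebraMap Q T)).map (· ^ k))).comap (algebraMap Q T) ≤
        LinearMap.ker f := by
      have hmap : (xs.map (algebraMap Q T)).map (· ^ k) =
          (xs.map (· ^ k)).map (algebraMap Q T) := by
        simp [List.map_map, Function.comp_def]
      rw [hmap, ← Ideal.map_ofList, Ideal.comap_map_of_surjective _ hQT]
      refine sup_le ?_ ?_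
      · intro a ha
        have h0 : U.mkQ (J.mkQ a) = 0 := by
          refine (Submodule.Quotient.mk_eq_zero _).mpr ?_
          have h1 : J.mkQ a = a • J.mkQ 1 := by rw [← map_smul, smul_eq_mul, mul_one]
          rw [h1]
          exact Submodule.smul_mem_smul ha trivial
        rw [LinearMap.mem_ker, LinearMap.comp_apply, LinearMap.comp_apply, h0, map_zero]
      · intro a ha
        obtain ⟨b, hb⟩ := Ideal.mem_span_singleton'.mp (Ideal.Quotient.eq_zero_iff_mem.mp ha)
        obtain ⟨b, rfl⟩ := Ideal.Quotient.mk_surjective b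
        have h1 : J.mkQ a = J.mkQ (s * b) := hb.symm.trans (by rw [mul_comm]; rfl)
        have h2 : f a = s • f b := by rw [← hsmul]; exact congrArg (Submodule.mkQ _ ∘ₗ U.mkQ) h1
        rw [LinearMap.mem_ker, h2]
        obtain ⟨y, hy⟩ : ∃ y, f b = Submodule.Quotient.mk y := ⟨_, rfl⟩
        rw [hy, ← Submodule.Quotient.mk_smul]
        exact (Submodule.Quotient.mk_eq_zero _).mpr ⟨y, trivial, rfl⟩
    exact ⟨Submodule.liftQ _ f hle, fun y => (hf y).imp' (Submodule.Quotient.mk) fun a ha => ha⟩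
  have hne : Ideal.ofList (xs.map (algebraMap Q T)) ≠ ⊤ := by
    refine ne_top_of_le_ne_top (maximalIdeal.isMaximal T).ne_top (Ideal.span_le.mpr ?_)
    intro r hr
    obtain ⟨x, hx, rfl⟩ := List.mem_map.mp hr
    exact map_nonunit (algebraMap Q T) x (hxs x hx)
  have hfinT : IsFiniteLength T (T ⧸ Ideal.ofList (xs.map (algebraMap Q T))) := by
    rw [← Module.length_ne_top_iff, ← length_quotient_comap hQT]
    refine ne_top_of_le_ne_top (Module.length_ne_top_iff.mpr hfin)
      (Module.length_le_of_surjective _ (Submodule.factor_surjective (sup_le ?_ ?_)))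
    · intro j hj
      have h0 : algebraMap Q T j = 0 :=
        (congrArg (algebraMap S T) (Ideal.Quotient.eq_zero_iff_mem.mpr hj)).trans (map_zero _)
      rw [Ideal.mem_comap, h0]
      exact zero_mem _
    · rw [← Ideal.map_ofList]
      exact Ideal.le_comap_map
  obtain ⟨c, hc⟩ := exists_length_quotient_ofList_pow_le hne hfinT hm
  refine ⟨c, fun k hk => ?_⟩
  obtain ⟨ρ, hρ⟩ := hsurj k
  have h1 := (Module.length_le_of_surjective ρ hρ).trans
    ((length_quotient_comap hQT _).le.trans (hc k hk))
  refine (mul_le_mul_right h1 (k : ℕ∞)).trans ?_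
  rw [← Nat.cast_mul, Nat.cast_le, mul_left_comm, ← pow_succ']
  exact Nat.mul_le_mul_left _ (Nat.pow_le_pow_right (Nat.pos_of_ne_zero hk) hmn)

/-- Every map kills J ∩ (xs) = (xs)J because (xs) kills the target, so every map descends to I. -/
theorem length_hom_le_of_isWeaklyRegular {R : Type u} {Q : Type v} [CommRing R] [CommRing Q]
    [Algebra Q R] (hπ : Function.Surjective (algebraMap Q R)) {J : Ideal Q} {I : Ideal R}
    (hJ : J.map (algebraMap Q R) = I) {xs : List Q} (reg : IsWeaklyRegular (Q ⧸ J) xs)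
    (hker : RingHom.ker (algebraMap Q R) = Ideal.ofList xs)
    (e : ((Q ⧸ J) ⧸ (Ideal.ofList xs • (⊤ : Submodule Q (Q ⧸ J)))) ≃ₗ[Q] (R ⧸ I)) :
    Module.length Q (J →ₗ[Q] ((Q ⧸ J) ⧸ (Ideal.ofList xs • (⊤ : Submodule Q (Q ⧸ J))))) ≤
      Module.length R (I →ₗ[R] (R ⧸ I)) := by
  rw [← Submodule.topEquiv.length_eq]
  refine length_submodule_hom_le hπ hJ e ⊤ fun φ _ j hj => ?_
  have hj' : (j : Q) ∈ Ideal.ofList xs := hker ▸ hj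
  have h1 : φ j ∈ Ideal.ofList xs •
      (⊤ : Submodule Q ((Q ⧸ J) ⧸ (Ideal.ofList xs • (⊤ : Submodule Q (Q ⧸ J))))) :=
    Submodule.smul_top_le_comap_smul_top _ φ (mem_ofList_smul_top_of_isWeaklyRegular reg hj')
  have h2 : Ideal.ofList xs •
      (⊤ : Submodule Q ((Q ⧸ J) ⧸ (Ideal.ofList xs • (⊤ : Submodule Q (Q ⧸ J))))) = ⊥ := by
    rw [eq_bot_iff, Submodule.smul_le]
    intro r hr x _
    obtain ⟨x, rfl⟩ := Submodule.mkQ_surjective _ x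
    rw [← map_smul]
    exact (Submodule.Quotient.mk_eq_zero _).mpr (Submodule.smul_mem_smul hr trivial)
  rw [h2] at h1
  exact h1

theorem IsSmoothable.conormalInequality {R : Type u} [CommRing R] [IsGorensteinLocalRing R]
    {I : Ideal R} (hfin : IsFiniteLength R (R ⧸ I)) (h : IsSmoothable.{u, v} I) :
    ConormalInequality I := by
  rcases eq_or_ne I ⊤ with rfl | hI
  · exact conormalInequality_top
  obtain ⟨Q, _, _, _, π, J, ⟨hπ, xs, regx, regS, hker, hJ⟩, hgen⟩ := h
  obtain ⟨ys, regy, hdim, hle⟩ :=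
    IsGorensteinLocalRing.exists_isRegular_of_isFiniteLength hI hfin
  rw [conormalInequality_iff hI hfin regy hle hdim
    (IsGorensteinLocalRing.hasCyclicSocle regy hdim)]
  let _ : Algebra Q R := π.toAlgebra
  obtain ⟨zs, hzs, rfl⟩ := exists_list_map_eq π (J := J) (ys := ys) fun y hy => by
    have hyI := hle (Ideal.subset_span hy)
    rw [← hJ, Ideal.mem_map_iff_of_surjective _ hπ] at hyI
    exact hyI
  rw [List.length_map]
  -- xs followed by zs is regular; permuting it makes zs an initial segment.
  have regz : IsWeaklyRegular Q zs :=
    ((isWeaklyRegular_append_iff Q zs xs).mp (IsLocalRing.isRegular_of_perm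
      (isRegular_append_of_surjective hπ regx hker regy)
        List.perm_append_comm).toIsWeaklyRegular).1
  obtain ⟨f, s, hs, hrange⟩ := hgen.exists_linearMap regz (Ideal.span_le.mpr hzs)
  have hcomap : I.comap π = J ⊔ Ideal.ofList xs := by
    rw [← hJ, Ideal.comap_map_of_surjective _ hπ, ← RingHom.ker_eq_comap_bot, hker]
  have hlenI : Module.length Q (Q ⧸ (J ⊔ Ideal.ofList xs)) = Module.length R (R ⧸ I) := by
    rw [← hcomap]
    exact length_quotient_comap hπ I
  have hfinQ : IsFiniteLength Q (Q ⧸ (J ⊔ Ideal.ofList xs)) := by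
    rw [← Module.length_ne_top_iff, hlenI]
    exact Module.length_ne_top_iff.mpr hfin
  obtain ⟨e₁⟩ := exists_quotient_sup_equiv J (Ideal.ofList xs)
  obtain ⟨e₂⟩ := exists_quotient_comap_equiv (Q := Q) hπ I
  let e := e₁.symm.trans ((Submodule.quotEquivOfEq _ _ hcomap.symm).trans e₂)
  obtain ⟨c, hc⟩ := exists_mul_length_quotSMulTop_le regS hfinQ hs
  rw [← hlenI, e₁.length_eq]
  have hX := (e₁.length_eq.symm.trans_ne (Module.length_ne_top_iff.mpr hfinQ))
  refine (mul_le_of_forall_pow_mul_le hX hc fun k hk => ?_).trans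
    (length_hom_le_of_isWeaklyRegular hπ hJ regS.toIsWeaklyRegular hker e)
  -- The bounds L and H are the actual lengths for k = 1, whence the multiplicity 1.
  have hb := HasLengthBounds.quotient_ofList_pow (J := J) (c := 1) (fun x hx =>
    mem_maximalIdeal_of_isRegular regx (Ideal.subset_span hx)) hk (Q ⧸ J) regS.toIsWeaklyRegular
      ⟨by rw [Nat.cast_one, one_mul], by rw [Nat.cast_one, one_mul]⟩
  rw [mul_one] at hb
  have hXk := hb.length_eq.trans_ne (natCast_mul_ne_top _ hX)
  have key := mul_length_le_of_smul_mem_range hrange hXk fun a ha x => by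
    obtain ⟨x, rfl⟩ := Submodule.mkQ_surjective _ x
    rw [← map_smul, smul_quotient_eq_zero ha, map_zero]
  rw [hb.length_eq] at key
  exact key.trans (add_le_add_left hb.length_hom_le _)

end Smoothable

theorem proposition5p5 {R : Type u} [CommRing R] [IsGorensteinLocalRing R] (I : Ideal R)
    (hI : IsFiniteLength R (R ⧸ I)) :
    (∀ (Q : Type v) [CommRing Q] [IsLocalRing Q] [IsNoetherianRing Q] (π : Q →+* R),
        DeformsAlong π (⊥ : Ideal R) (⊥ : Ideal Q) → ConormalInequality (I.comap π) →
          ConormalInequality I) ∧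
      (IsSmoothable.{u, v} I → ConormalInequality I) ∧
      (IsLicci I → ConormalInequality I) := by
  refine ⟨fun Q _ _ _ π hdef hQ => ConormalInequality.of_deformsAlong hI hdef hQ,
    fun h => h.conormalInequality hI, fun h => ?_⟩
  rcases eq_or_ne I ⊤ with rfl | hne
  · exact conormalInequality_top
  obtain ⟨ys, regy, hdim, hle⟩ :=
    IsGorensteinLocalRing.exists_isRegular_of_isFiniteLength hne hI
  rw [conormalInequality_iff hne hI regy hle hdim
    (IsGorensteinLocalRing.hasCyclicSocle regy hdim)]
  exact h.length_le hdim hI
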